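/- Consider the time-invariant driftless system $\dot x=\sum_{k=1}^m u_k f_k(x)$ on a domain (nonempty, open and connected set) $D\subseteq\mathbb R^n$, with $f_k\in C^2(D;\mathbb R^n)$. Suppose it satisfies the bracket-generating condition of degree 2 in $D$: there are index sets $S_1\subseteq\{1,\dots,m\}$, $S_2\subseteq\{1,\dots,m\}^2$ with $|S_1|+|S_2|=n$ such that, for every $x\in D$, the vectors $f_i(x)$ ($i\in S_1$) and $[f_{j_1},f_{j_2}](x)$ ($(j_1,j_2)\in S_2$), where $[f,g]=Dg\,f-Df\,g$, span $\mathbb R^n$. Let $\mathcal F(x)$ be the (hence nonsingular) $n\times n$ matrix with these columns. Let $\kappa_{j_1j_2}$, $(j_1,j_2)\in S_2$, be pairwise distinct positive integers. Let $\mathcal K$ denote the set of continuous strictly increasing functions $w:[0,\infty)\to[0,\infty)$ with $w(0)=0$. Let $x^*\in D$, $m_P\in\mathbb R$, and let $P\in C^2(D;\mathbb R)$ satisfy: 1. there are $w_{11},w_{12}\in\mathcal K$ such that $w_{11}(\|x-x^*\|)\le P(x)-m_P\le w_{12}(\|x-x^*\|)$ for all $x\in D$, and $\{x\in\mathbb R^n:\|x-x^*\|\le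 w_{11}^{-1}(P(x^0)-m_P)\}\subseteq D$ for every $x^0\in D$ for which $w_{11}^{-1}(P(x^0)-m_P)$ is defined; 2. for $x\in D$, $\|\nabla P(x)\|=0$ if and only if $x=x^*$, and there is $w_2\in\mathcal K$ such that $\|\nabla P(x)\|\le w_2(\|x-x^*\|)$ for all $x\in D$. For $\gamma>0$ and $\varepsilon>0$ let $a(x)=-\gamma\,\mathcal F(x)^{-1}\nabla P(x)$, with components $a_i$ ($i\in S_1$) and $a_{j_1j_2}$ ($(j_1,j_2)\in S_2$), and let $$u_k^\varepsilon(a,t)=\sum_{i\in S_1}a_i\,\delta_{ki}+\varepsilon^{-1/2}\sum_{(j_1,j_2)\in S_2}\sqrt{|a_{j_1j_2}|}\;2\sqrt{\pi\kappa_{j_1j_2}}\Big(\delta_{kj_1}\,\mathrm{sign}(a_{j_1j_2})\cos\tfrac{2\pi\kappa_{j_1j_2}t}{\varepsilon}+\delta_{kj_2}\sin\tfrac{2\pi\kappa_{j_1j_2}t}{\varepsilon}\Big),\quad k=1,\dots,m.$$ A $\pi_\varepsilon$-solution of the closed loop with initial data $t_0\in\mathbb R$, $x^0$ is a (locally) absolutely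 continuous function $x_\pi:[t_0,\infty)\to D$ with $x_\pi(t_0)=x^0$ such that, with $t_j=t_0+\varepsilon j$, $$\dot x_\pi(t)=\sum_{k=1}^m u_k^\varepsilon\big(a(x_\pi(t_j)),t\big)f_k(x_\pi(t))\quad\text{for } t\in[t_j,t_{j+1}),\ j=0,1,2,\dots$$ (the right derivative is meant at $t=t_j$). Then for every $\gamma>0$ there is $\bar\varepsilon>0$ such that, for every $\varepsilon\in(0,\bar\varepsilon)$, the point $x^*$ is asymptotically stable for the closed-loop system in the sense of $\pi_\varepsilon$-solutions. That is: - there is $\delta>0$ such that for all $t_0\in\mathbb R$ and all $x^0$ with $\|x^0-x^*\|<\delta$ a $\pi_\varepsilon$-solution with initial data $t_0,x^0$ exists (on the whole of $[t_0,\infty)$); - for every $\eta>0$ there is $\delta>0$ such that for all $t_0\in\mathbb R$ and all $x^0$ with $\|x^0-x^*\|<\delta$, every $\pi_\varepsilon$-solution with initial data $t_0,x^0$ satisfies $\|x_\pi(t)-x^*\|<\eta$ for all $t\ge t_0$; - there is $\delta>0$ such that for all $t_0\in\mathbb R$ and all $x^0$ with $\|x^0-x^*\|<\delta$, every $\pi_\varepsilon$-solution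 with initial data $t_0,x^0$ satisfies $x_\pi(t)\to x^*$ as $t\to\infty$. -/

import Mathlib

noncomputable section

namespace NonholonomicStab

/-- The state space: `n`-dimensional Euclidean space. -/
abbrev State (n : ℕ) : Type := EuclideanSpace ℝ (Fin n)

/-- Class `𝒦`: continuous strictly increasing functions on `[0, ∞)` vanishing at `0`. -/
structure IsClassK (w : ℝ → ℝ) : Prop where
  continuousOn : ContinuousOn w (Set.Ici 0)
  strictMonoOn : StrictMonoOn w (Set.Ici 0)
  map_zero : w 0 = 0

/-- `x` is a `π_ε`-solution, with initial data `x t₀ = x₀`, of the closed-loop system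
`ẋ = F(x, u, t)`, `u = h (a(x, t), t)` in `D`: the argument of `a` is sampled at the times
`t_j = t₀ + ε j`, while `h` and `F` are evaluated at the current time.
At a left endpoint `t_j` the derivative is the right derivative. -/
structure IsPiSolution {n : ℕ} {U A : Type*} (D : Set (State n))
    (F : State n → U → ℝ → State n) (h : A → ℝ → U) (a : State n → ℝ → A)
    (ε t₀ : ℝ) (x₀ : State n) (x : ℝ → State n) : Prop where
  absCont : ∀ T, t₀ ≤ T → AbsolutelyContinuousOnInterval x t₀ T
  mem : ∀ t, t₀ ≤ t → x t ∈ D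
  init : x t₀ = x₀
  ode : ∀ j : ℕ, ∀ t ∈ Set.Ico (t₀ + ε * j) (t₀ + ε * (j + 1)),
    HasDerivWithinAt x
      (F (x t) (h (a (x (t₀ + ε * j)) (t₀ + ε * j)) t) t)
      (Set.Ico (t₀ + ε * j) (t₀ + ε * (j + 1))) t

/-- Asymptotic stability of the point `xs`, for solutions given by the relation
`Sol t₀ x₀ x` (`x` is a solution on `[t₀, ∞)` with `x t₀ = x₀`): solutions starting near `xs`
exist on `[t₀, ∞)`, `xs` is Lyapunov stable, and `xs` is (locally) attractive. -/
structure IsAsymptoticallyStable {n : ℕ} (Sol : ℝ → State n → (ℝ → State n) → Prop)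
    (xs : State n) : Prop where
  exists_solution : ∃ δ > 0, ∀ t₀ : ℝ, ∀ x₀ : State n, ‖x₀ - xs‖ < δ → ∃ x, Sol t₀ x₀ x
  stable : ∀ η > 0, ∃ δ > 0, ∀ t₀ : ℝ, ∀ x₀ : State n, ‖x₀ - xs‖ < δ →
    ∀ x, Sol t₀ x₀ x → ∀ t, t₀ ≤ t → ‖x t - xs‖ < η
  attractive : ∃ δ > 0, ∀ t₀ : ℝ, ∀ x₀ : State n, ‖x₀ - xs‖ < δ →
    ∀ x, Sol t₀ x₀ x → Filter.Tendsto x Filter.atTop (nhds xs)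

section System

variable {n m : ℕ}

/-- The right-hand side `∑ₖ uₖ fₖ(x)` of the driftless system. -/
def driftless (f : Fin m → State n → State n) (x : State n) (u : Fin m → ℝ) (_t : ℝ) : State n :=
  ∑ k, u k • f k x

/-- Labels of the columns of `𝓕`: the disjoint union of `S₁` and `S₂`. -/
abbrev Label (S₁ : Finset (Fin m)) (S₂ : Finset (Fin m × Fin m)) : Type := ↥S₁ ⊕ ↥S₂

/-- The columns of `𝓕(x)`: `f_i(x)` for `i ∈ S₁` and `[f_{j₁}, f_{j₂}](x)` for
`(j₁, j₂) ∈ S₂`, with `[f, g] = Dg f - Df g`. -/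
def column (f : Fin m → State n → State n) (S₁ : Finset (Fin m)) (S₂ : Finset (Fin m × Fin m))
    (x : State n) : Label S₁ S₂ → State n
  | Sum.inl i => f i.1 x
  | Sum.inr j => VectorField.lieBracket ℝ (f j.1.1) (f j.1.2) x

/-- The bracket-generating condition of degree 2 in `D`, with index sets `S₁`, `S₂`. -/
structure IsBracketGenerating (f : Fin m → State n → State n) (D : Set (State n))
    (S₁ : Finset (Fin m)) (S₂ : Finset (Fin m × Fin m)) : Prop where
  card_eq : S₁.card + S₂.card = n
  span_eq : ∀ x ∈ D, Submodule.span ℝ (Set.range (column f S₁ S₂ x)) = ⊤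

/-- The matrix `𝓕(x)`, as the linear map `a ↦ 𝓕(x) a`. -/
def bracketMap (f : Fin m → State n → State n) (S₁ : Finset (Fin m))
    (S₂ : Finset (Fin m × Fin m)) (x : State n) : (Label S₁ S₂ → ℝ) →L[ℝ] State n :=
  ∑ l, (ContinuousLinearMap.proj l : (Label S₁ S₂ → ℝ) →L[ℝ] ℝ).smulRight (column f S₁ S₂ x l)

/-- The coefficients `a(x) = -γ 𝓕(x)⁻¹ ∇P(x)`. -/
def coeff (f : Fin m → State n → State n) (S₁ : Finset (Fin m)) (S₂ : Finset (Fin m × Fin m))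
    (P : State n → ℝ) (γ : ℝ) (x : State n) : Label S₁ S₂ → ℝ :=
  -γ • (bracketMap f S₁ S₂ x).inverse (gradient P x)

/-- The dither `φ_{j₁ j₂}^{(k, ε)}(t)`, where `s` is the coefficient `a_{j₁ j₂}`. -/
def dither (κ : Fin m × Fin m → ℕ) (ε : ℝ) (j : Fin m × Fin m) (k : Fin m) (s t : ℝ) : ℝ :=
  2 * √(Real.pi * κ j) *
    ((if k = j.1 then Real.sign s * Real.cos (2 * Real.pi * κ j / ε * t) else 0) +
      (if k = j.2 then Real.sin (2 * Real.pi * κ j / ε * t) else 0))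

/-- The oscillating controls `u_k^ε(a, t)`. -/
def oscControl (S₁ : Finset (Fin m)) (S₂ : Finset (Fin m × Fin m)) (κ : Fin m × Fin m → ℕ) (ε : ℝ)
    (a : Label S₁ S₂ → ℝ) (t : ℝ) (k : Fin m) : ℝ :=
  (∑ i : ↥S₁, if k = i.1 then a (Sum.inl i) else 0) +
    (√ε)⁻¹ * ∑ j : ↥S₂, √|a (Sum.inr j)| * dither κ ε j.1 k (a (Sum.inr j)) t

/-- `x` is a `π_ε`-solution of the driftless system in `D` with the oscillating controls. -/
def IsClosedLoopSolution (D : Set (State n)) (f : Fin m → State n → State n)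
    (S₁ : Finset (Fin m)) (S₂ : Finset (Fin m × Fin m)) (κ : Fin m × Fin m → ℕ)
    (P : State n → ℝ) (γ ε t₀ : ℝ) (x₀ : State n) (x : ℝ → State n) : Prop :=
  IsPiSolution D (driftless f) (oscControl S₁ S₂ κ ε) (fun y _ => coeff f S₁ S₂ P γ y) ε t₀ x₀ x

end System

end NonholonomicStab

end

/-! Freeze the coefficients `a` over one sampling period and put q = √(ε‖a‖). The constant controls
act at order q² over the period and the oscillating ones at order q, but the latter have mean zero.
Their second iterated integrals over a period are antisymmetric and, the frequencies being distinct,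
couple only the cosine and sine of the same label; the amplitudes are tuned so that this coupling
yields exactly ε a_j times the Lie bracket. So the displacement is ε 𝓕(x)a + O(q³)
(`norm_sub_bracketMap_le`), which for the chosen `a` is a gradient step -εγ∇P plus O(q³).

Near x*, 𝓕⁻¹ is bounded, hence ‖a‖ ≤ A‖∇P‖ and q³ ≤ q · εA‖∇P‖: the error is small relative to the
step itself. This gives genuine asymptotic stability instead of convergence to a small
neighbourhood. For small ε, P drops by at least (γ/2)ε‖∇P‖² in each period
(`exists_period_descent`).

The rest is a discrete Lyapunov argument. The part of a ball of radius ρ where P - m_P ≤ w₁₁(ρ) is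
invariant from sample to sample (`HasPeriodDescent.mem_trappingSet`). The total decrease of P is
finite, so ∇P tends to 0 along the samples; compactness and uniqueness of the critical point give
convergence. Between samples the solution stays within O(√‖∇P‖) of the last sample. Existence
follows by gluing Picard–Lindelöf solutions period by period. -/

namespace NonholonomicStab

open Set
open scoped Topology NNReal

/-! ### Second order expansion of solutions -/

section Expansion

variable {E : Type*} [NormedAddCommGroup E] [NormedSpace ℝ E]

/-- A curve whose speed is at most `B` while it is within distance `ρ` of its starting point
stays within that distance as long as `B T < ρ`, and its displacement is at most `B (t - s)`. -/
theorem norm_sub_le_of_speed_le_on_closedBall {x : ℝ → E} {x' : ℝ → E} {s T B ρ : ℝ}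
    (hB : 0 ≤ B) (hT : 0 < T) (hx : ContinuousOn x (Icc s (s + T)))
    (hx' : ∀ t ∈ Ico s (s + T), HasDerivWithinAt x (x' t) (Ici t) t)
    (hspeed : ∀ t ∈ Ico s (s + T), x t ∈ Metric.closedBall (x s) ρ → ‖x' t‖ ≤ B)
    (hBT : B * T < ρ) :
    ∀ t ∈ Icc s (s + T), ‖x t - x s‖ ≤ B * (t - s) := by
  -- A rough bound with slope ρ/T > B comes first: wherever it is attained the curve is still in the
  -- ball, so its speed is at most B, strictly below the slope. Once the curve is known to stay in
  -- the ball, the slope improves to B.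
  have key : ∀ t ∈ Icc s (s + T), ‖x t - x s‖ ≤ ρ / T * (t - s) := by
    have hlt : B < ρ / T := by rwa [lt_div_iff₀ hT]
    refine image_norm_le_of_norm_deriv_right_lt_deriv_boundary
      (f := fun t => x t - x s) (f' := x') (B' := fun _ => ρ / T)
      (hx.sub continuousOn_const) (fun t ht => (hx' t ht).sub_const _) (by simp) ?_ ?_
    · intro t
      simpa using ((hasDerivAt_id t).sub_const s).const_mul (ρ / T)
    · intro t ht h
      refine (hspeed t ht ?_).trans_lt hlt
      rw [mem_closedBall_iff_norm, h]
      have : ρ / T * (t - s) ≤ ρ / T * T := by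
        have : 0 ≤ ρ / T := hB.trans hlt.le
        gcongr
        linarith [ht.2]
      rwa [div_mul_cancel₀ _ hT.ne'] at this
  refine norm_image_sub_le_of_norm_deriv_right_le_segment hx hx' fun t ht => hspeed t ht ?_
  rw [mem_closedBall_iff_norm]
  refine (key t ⟨ht.1, ht.2.le⟩).trans ?_
  have : ρ / T * (t - s) ≤ ρ / T * T := by
    have : 0 ≤ ρ / T := div_nonneg ((mul_nonneg hB hT.le).trans hBT.le) hT.le
    gcongr
    linarith [ht.2]
  rwa [div_mul_cancel₀ _ hT.ne'] at this

variable {ι : Type*} [Fintype ι]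

theorem norm_sum_smul_le {c : ι → ℝ} {v : ι → E} {α K : ℝ} (hα : 0 ≤ α)
    (hc : ∀ k, |c k| ≤ α) (hv : ∀ k, ‖v k‖ ≤ K) :
    ‖∑ k, c k • v k‖ ≤ Fintype.card ι * (α * K) := by
  refine (norm_sum_le _ _).trans ?_
  have : ∀ k ∈ Finset.univ, ‖c k • v k‖ ≤ α * K := fun k _ => by
    rw [norm_smul, Real.norm_eq_abs]
    exact mul_le_mul (hc k) (hv k) (norm_nonneg _) hα
  simpa using Finset.sum_le_sum this

/-- Uniform bounds on a family of vector fields, and on the iterated derivatives `D f_k f_l`,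
on a set `S`. -/
structure FieldBounds (f : ι → E → E) (S : Set E) (K : ℝ) : Prop where
  differentiableAt : ∀ k, ∀ x ∈ S, DifferentiableAt ℝ (f k) x
  norm_le : ∀ k, ∀ x ∈ S, ‖f k x‖ ≤ K
  lipschitz : ∀ k, ∀ x ∈ S, ∀ y ∈ S, ‖f k x - f k y‖ ≤ K * ‖x - y‖
  norm_fderiv_le : ∀ k l, ∀ x ∈ S, ‖fderiv ℝ (f k) x (f l x)‖ ≤ K
  lipschitz_fderiv : ∀ k l, ∀ x ∈ S, ∀ y ∈ S,
    ‖fderiv ℝ (f k) x (f l x) - fderiv ℝ (f k) y (f l y)‖ ≤ K * ‖x - y‖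

/-- Second order expansion of a solution of `ẋ = ∑ₖ (Aₖ + wₖ(t)) fₖ(x)`. -/
theorem norm_sub_expansion_le {f : ι → E → E} {S : Set E} {K : ℝ} (hf : FieldBounds f S K)
    (hK : 0 ≤ K) {s T : ℝ} (hT : 0 < T) {A : ι → ℝ} {w W : ι → ℝ → ℝ} {V : ι → ι → ℝ → ℝ}
    (hW : ∀ k t, HasDerivAt (W k) (w k t) t) (hWs : ∀ k, W k s = 0)
    (hV : ∀ k l t, HasDerivAt (V k l) (w k t * W l t) t) (hVs : ∀ k l, V k l s = 0)
    {c q : ℝ} (hc : 0 ≤ c) (hq : 0 ≤ q) (hq1 : q ≤ 1)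
    (hA : ∀ k, |A k| * T ≤ c * q ^ 2) (hw : ∀ k t, |w k t| * T ≤ c * q)
    {x : ℝ → E} (hx : ContinuousOn x (Icc s (s + T))) (hxS : ∀ t ∈ Icc s (s + T), x t ∈ S)
    (hx' : ∀ t ∈ Ico s (s + T),
      HasDerivWithinAt x (∑ k, (A k + w k t) • f k (x t)) (Ici t) t) :
    ‖x (s + T) - x s - T • ∑ k, A k • f k (x s) - ∑ k, W k (s + T) • f k (x s)
        - ∑ k, ∑ l, V k l (s + T) • fderiv ℝ (f k) (x s) (f l (x s))‖
      ≤ (Fintype.card ι ^ 2 * K * c ^ 2 * (2 * K + 1 + 2 * Fintype.card ι * K * c)) * q ^ 3 := by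
  set m : ℝ := (Fintype.card ι : ℝ) with hm
  have hm0 : 0 ≤ m := Nat.cast_nonneg _
  set α := c * q ^ 2 / T with hα
  set ω := c * q / T with hω
  have hα0 : 0 ≤ α := by positivity
  have hω0 : 0 ≤ ω := by positivity
  have hAα : ∀ k, |A k| ≤ α := fun k => by rw [hα, le_div_iff₀ hT]; exact hA k
  have hwω : ∀ k t, |w k t| ≤ ω := fun k t => by rw [hω, le_div_iff₀ hT]; exact hw k t
  have hαω : α ≤ ω := by
    rw [hα, hω]
    gcongr
    nlinarith
  have hsS : x s ∈ S := hxS s ⟨le_rfl, by linarith⟩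
  have hIco : ∀ {t}, t ∈ Ico s (s + T) → t ∈ Icc s (s + T) := fun h => Ico_subset_Icc_self h
  have hdisp : ∀ t ∈ Icc s (s + T), ‖x t - x s‖ ≤ m * (2 * ω * K) * T := by
    intro t ht
    refine (norm_image_sub_le_of_norm_deriv_right_le_segment hx hx'
      (C := m * (2 * ω * K)) (fun t ht => ?_) t ht).trans ?_
    · refine norm_sum_smul_le (by positivity) (fun k => ?_) (fun k => hf.norm_le k _ (hxS t (hIco ht)))
      refine (abs_add_le _ _).trans ?_
      linarith [hAα k, hwω k t]
    · gcongr
      linarith [ht.2]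
  set d := m * (2 * ω * K) * T with hd
  have hd0 : 0 ≤ d := by positivity
  -- Here α is of order q²/T, ω of order q/T and d of order q, so both terms of Q are of order q²/T.
  set Q := m * (α * K) + m * (ω * (K * d)) with hQ
  have hQ0 : 0 ≤ Q := by positivity
  -- First order expansion of `f k` along the curve. It is fed back into the equation below, where
  -- the factor `w` supplies the third power of q.
  have h1 : ∀ k, ∀ t ∈ Icc s (s + T),
      ‖f k (x t) - f k (x s) - ∑ l, W l t • fderiv ℝ (f k) (x s) (f l (x s))‖ ≤ Q * T := by
    intro k t ht
    set z : ℝ → E := fun t => f k (x t) - ∑ l, W l t • fderiv ℝ (f k) (x s) (f l (x s)) with hz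
    have hzs : z s = f k (x s) := by simp [hz, hWs]
    have hz' : ∀ t ∈ Ico s (s + T), HasDerivWithinAt z
        (fderiv ℝ (f k) (x t) (∑ l, (A l + w l t) • f l (x t)) -
          ∑ l, w l t • fderiv ℝ (f k) (x s) (f l (x s))) (Ici t) t := by
      intro t ht
      refine HasDerivWithinAt.sub ?_ ?_
      · exact ((hf.differentiableAt k _ (hxS t (hIco ht))).hasFDerivAt).comp_hasDerivWithinAt t
          (hx' t ht)
      · exact HasDerivWithinAt.fun_sum fun l _ => ((hW l t).hasDerivWithinAt).smul_const _
    have hzc : ContinuousOn z (Icc s (s + T)) := by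
      refine ContinuousOn.sub ?_ ?_
      · intro t ht
        exact (hf.differentiableAt k _ (hxS t ht)).continuousAt.comp_continuousWithinAt (hx t ht)
      · exact continuousOn_finsetSum _ fun l _ =>
          (fun t _ => ((hW l t).continuousAt.continuousWithinAt).smul continuousWithinAt_const)
    have := norm_image_sub_le_of_norm_deriv_right_le_segment hzc hz' (C := Q) (fun t ht => ?_) t ht
    · rw [hzs, hz] at this
      rw [sub_right_comm]
      refine this.trans ?_
      gcongr
      linarith [ht.2]
    · have e : fderiv ℝ (f k) (x t) (∑ l, (A l + w l t) • f l (x t)) -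
          ∑ l, w l t • fderiv ℝ (f k) (x s) (f l (x s)) =
          ∑ l, A l • fderiv ℝ (f k) (x t) (f l (x t)) + ∑ l, w l t •
            (fderiv ℝ (f k) (x t) (f l (x t)) - fderiv ℝ (f k) (x s) (f l (x s))) := by
        rw [map_sum]
        simp only [map_smul]
        simp only [add_smul, smul_sub, Finset.sum_add_distrib,
          Finset.sum_sub_distrib]
        abel
      rw [e]
      refine (norm_add_le _ _).trans (add_le_add ?_ ?_)
      · exact norm_sum_smul_le hα0 hAα fun l => hf.norm_fderiv_le k l _ (hxS t (hIco ht))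
      · refine norm_sum_smul_le hω0 (hwω · t) fun l =>
          (hf.lipschitz_fderiv k l _ (hxS t (hIco ht)) _ hsS).trans ?_
        gcongr
        exact hdisp t (hIco ht)
  set z : ℝ → E := fun t => x t - (t - s) • ∑ k, A k • f k (x s) - ∑ k, W k t • f k (x s)
        - ∑ k, ∑ l, V k l t • fderiv ℝ (f k) (x s) (f l (x s)) with hz
  have hzs : z s = x s := by simp [hz, hWs, hVs]
  have hz' : ∀ t ∈ Ico s (s + T), HasDerivWithinAt z
      (∑ k, (A k + w k t) • f k (x t) - (1 : ℝ) • ∑ k, A k • f k (x s) - ∑ k, w k t • f k (x s) -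
        ∑ k, ∑ l, (w k t * W l t) • fderiv ℝ (f k) (x s) (f l (x s))) (Ici t) t := by
    intro t ht
    refine HasDerivWithinAt.sub (HasDerivWithinAt.sub (HasDerivWithinAt.sub (hx' t ht) ?_) ?_) ?_
    · exact (((hasDerivAt_id t).sub_const s).smul_const _).hasDerivWithinAt
    · exact HasDerivWithinAt.fun_sum fun l _ => ((hW l t).hasDerivWithinAt).smul_const _
    · exact HasDerivWithinAt.fun_sum fun k _ => HasDerivWithinAt.fun_sum fun l _ =>
        ((hV k l t).hasDerivWithinAt).smul_const _
  have hzc : ContinuousOn z (Icc s (s + T)) := by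
    have hWc : ∀ k, Continuous (W k) := fun k =>
      continuous_iff_continuousAt.2 fun t => (hW k t).continuousAt
    have hVc : ∀ k l, Continuous (V k l) := fun k l =>
      continuous_iff_continuousAt.2 fun t => (hV k l t).continuousAt
    have h2 : Continuous fun t => ∑ k, W k t • f k (x s) := by fun_prop
    have h3 : Continuous fun t => ∑ k, ∑ l, V k l t • fderiv ℝ (f k) (x s) (f l (x s)) := by
      fun_prop
    have h4 : Continuous fun t => (t - s) • ∑ k, A k • f k (x s) := by fun_prop
    exact ((hx.sub h4.continuousOn).sub h2.continuousOn).sub h3.continuousOn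
  have key := norm_image_sub_le_of_norm_deriv_right_le_segment hzc hz'
    (C := m * (α * (K * d)) + m * (ω * (Q * T))) (fun t ht => ?_) (s + T)
    ⟨by linarith, le_rfl⟩
  · rw [hzs, hz] at key
    have hαT : α * T = c * q ^ 2 := by rw [hα, div_mul_cancel₀ _ hT.ne']
    have hωT : ω * T = c * q := by rw [hω, div_mul_cancel₀ _ hT.ne']
    have e1 : (m * (α * (K * d)) + m * (ω * (Q * T))) * (s + T - s) =
        (m ^ 2 * K * c ^ 2 * (2 * K + 1 + 2 * m * K * c)) * q ^ 3 := by
      rw [hQ, hd]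
      calc _ = m ^ 2 * K * (2 * K * (α * T) * (ω * T) + (α * T) * (ω * T)
            + 2 * m * K * (ω * T) ^ 3) := by ring
        _ = _ := by rw [hαT, hωT]; ring
    rw [← e1]
    convert key using 2
    simp only [add_sub_cancel_left]
    abel
  · have e : ∑ k, (A k + w k t) • f k (x t) - (1 : ℝ) • ∑ k, A k • f k (x s) -
        ∑ k, w k t • f k (x s) -
          ∑ k, ∑ l, (w k t * W l t) • fderiv ℝ (f k) (x s) (f l (x s)) =
        ∑ k, A k • (f k (x t) - f k (x s)) + ∑ k, w k t •
          (f k (x t) - f k (x s) - ∑ l, W l t • fderiv ℝ (f k) (x s) (f l (x s))) := by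
      simp only [add_smul, smul_sub, Finset.sum_add_distrib, Finset.sum_sub_distrib, one_smul,
        Finset.smul_sum, mul_smul]
      abel
    rw [e]
    refine (norm_add_le _ _).trans (add_le_add ?_ ?_)
    · refine norm_sum_smul_le hα0 hAα fun k => (hf.lipschitz k _ (hxS t (hIco ht)) _ hsS).trans ?_
      gcongr
      exact hdisp t (hIco ht)
    · exact norm_sum_smul_le hω0 (hwω · t) fun k => h1 k t (hIco ht)

end Expansion

/-! ### Integrals of trigonometric polynomials over a period -/

section TrigonometricIntegrals

open Real intervalIntegral

theorem integral_cos_int_period {ε : ℝ} (hε : 0 < ε) {N : ℤ} (hN : N ≠ 0) (s : ℝ) :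
    ∫ t in s..s + ε, cos (2 * π * N / ε * t) = 0 := by
  have hc : 2 * π * N / ε ≠ 0 := by positivity
  rw [integral_comp_mul_left _ hc, integral_cos]
  have : 2 * π * N / ε * (s + ε) = 2 * π * N / ε * s + N * (2 * π) := by field_simp
  rw [this, sin_add_int_mul_two_pi, sub_self, smul_zero]

theorem integral_sin_int_period {ε : ℝ} (hε : 0 < ε) (N : ℤ) (s : ℝ) :
    ∫ t in s..s + ε, sin (2 * π * N / ε * t) = 0 := by
  rcases eq_or_ne N 0 with rfl | hN
  · simp
  have hc : 2 * π * N / ε ≠ 0 := by positivity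
  rw [integral_comp_mul_left _ hc, integral_sin]
  have : 2 * π * N / ε * (s + ε) = 2 * π * N / ε * s + N * (2 * π) := by field_simp
  rw [this, cos_add_int_mul_two_pi, sub_self, smul_zero]

variable {ε : ℝ} (a b : ℕ) (s : ℝ)

/-- Product-to-sum: `0 < a` keeps the sum frequency nonzero, so only a vanishing difference
frequency can contribute. -/
theorem integral_cos_mul_cos (hε : 0 < ε) (ha : 0 < a) :
    ∫ t in s..s + ε, cos (2 * π * a / ε * t) * cos (2 * π * b / ε * t) =
      if a = b then ε / 2 else 0 := by
  have e : ∀ t, cos (2 * π * a / ε * t) * cos (2 * π * b / ε * t) =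
      2⁻¹ * (cos (2 * π * ((a - b : ℤ) : ℝ) / ε * t) + cos (2 * π * ((a + b : ℤ) : ℝ) / ε * t)) := by
    intro t
    have h1 : 2 * π * ((a - b : ℤ) : ℝ) / ε * t = 2 * π * a / ε * t - 2 * π * b / ε * t := by
      push_cast; ring
    have h2 : 2 * π * ((a + b : ℤ) : ℝ) / ε * t = 2 * π * a / ε * t + 2 * π * b / ε * t := by
      push_cast; ring
    rw [h1, h2, cos_sub, cos_add]; ring
  simp_rw [e]
  rw [integral_const_mul, integral_add (Continuous.intervalIntegrable (by fun_prop) _ _)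
    (Continuous.intervalIntegrable (by fun_prop) _ _),
    integral_cos_int_period hε (N := a + b) (by positivity)]
  split_ifs with h
  · subst h; simp; ring
  · rw [integral_cos_int_period hε (by omega)]; simp

theorem integral_sin_mul_sin (hε : 0 < ε) (ha : 0 < a) :
    ∫ t in s..s + ε, sin (2 * π * a / ε * t) * sin (2 * π * b / ε * t) =
      if a = b then ε / 2 else 0 := by
  have e : ∀ t, sin (2 * π * a / ε * t) * sin (2 * π * b / ε * t) =
      2⁻¹ * (cos (2 * π * ((a - b : ℤ) : ℝ) / ε * t) - cos (2 * π * ((a + b : ℤ) : ℝ) / ε * t)) := by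
    intro t
    have h1 : 2 * π * ((a - b : ℤ) : ℝ) / ε * t = 2 * π * a / ε * t - 2 * π * b / ε * t := by
      push_cast; ring
    have h2 : 2 * π * ((a + b : ℤ) : ℝ) / ε * t = 2 * π * a / ε * t + 2 * π * b / ε * t := by
      push_cast; ring
    rw [h1, h2, cos_sub, cos_add]; ring
  simp_rw [e]
  rw [integral_const_mul, integral_sub (Continuous.intervalIntegrable (by fun_prop) _ _)
    (Continuous.intervalIntegrable (by fun_prop) _ _),
    integral_cos_int_period hε (N := a + b) (by positivity)]
  split_ifs with h
  · subst h; simp; ring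
  · rw [integral_cos_int_period hε (by omega)]; simp

theorem integral_sin_mul_cos (hε : 0 < ε) :
    ∫ t in s..s + ε, sin (2 * π * a / ε * t) * cos (2 * π * b / ε * t) = 0 := by
  have e : ∀ t, sin (2 * π * a / ε * t) * cos (2 * π * b / ε * t) =
      2⁻¹ * (sin (2 * π * ((a - b : ℤ) : ℝ) / ε * t) + sin (2 * π * ((a + b : ℤ) : ℝ) / ε * t)) := by
    intro t
    have h1 : 2 * π * ((a - b : ℤ) : ℝ) / ε * t = 2 * π * a / ε * t - 2 * π * b / ε * t := by
      push_cast; ring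
    have h2 : 2 * π * ((a + b : ℤ) : ℝ) / ε * t = 2 * π * a / ε * t + 2 * π * b / ε * t := by
      push_cast; ring
    rw [h1, h2, sin_sub, sin_add]; ring
  simp_rw [e]
  rw [integral_const_mul, integral_add (Continuous.intervalIntegrable (by fun_prop) _ _)
    (Continuous.intervalIntegrable (by fun_prop) _ _),
    integral_sin_int_period hε, integral_sin_int_period hε]
  simp

variable {a b s}

/-- First and second iterated integrals of trigonometric polynomials with distinct positive
frequencies, over one common period starting at an arbitrary time. -/
theorem exists_iterated_integrals {ι J : Type*} [Fintype J] (hε : 0 < ε) {κ : J → ℕ}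
    (hκ : ∀ j, 0 < κ j) (hinj : Function.Injective κ) (p q : ι → J → ℝ) (s : ℝ) {w : ι → ℝ → ℝ}
    (hw : ∀ k t, w k t =
      ∑ j, (p k j * cos (2 * π * κ j / ε * t) + q k j * sin (2 * π * κ j / ε * t))) :
    ∃ (W : ι → ℝ → ℝ) (V : ι → ι → ℝ → ℝ),
      (∀ k t, HasDerivAt (W k) (w k t) t) ∧ (∀ k, W k s = 0) ∧
      (∀ k l t, HasDerivAt (V k l) (w k t * W l t) t) ∧ (∀ k l, V k l s = 0) ∧
      (∀ k, W k (s + ε) = 0) ∧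
      (∀ k l, V k l (s + ε) =
        ∑ j, (q k j * p l j - p k j * q l j) * (ε ^ 2 / (4 * π * κ j))) := by
  classical
  have hκ0 : ∀ j, (κ j : ℝ) ≠ 0 := fun j => by have := hκ j; positivity
  have hν : ∀ j, 2 * π * κ j / ε ≠ 0 := fun j => by have := hκ j; positivity
  have hwc : ∀ k, Continuous (w k) := fun k => by
    rw [show w k = _ from funext (hw k)]; fun_prop
  set Y : ι → ℝ → ℝ := fun l t =>
    ∑ j, (p l j * sin (2 * π * κ j / ε * t) - q l j * cos (2 * π * κ j / ε * t))
      / (2 * π * κ j / ε) with hY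
  have hYd : ∀ l t, HasDerivAt (Y l) (w l t) t := by
    intro l t
    rw [hw]
    refine HasDerivAt.fun_sum fun j _ => ?_
    have h1 := (hasDerivAt_id' t).const_mul (2 * π * κ j / ε)
    have h2 := ((h1.sin.const_mul (p l j)).sub (h1.cos.const_mul (q l j))).div_const
      (2 * π * κ j / ε)
    refine h2.congr_deriv ?_
    have := hκ0 j
    field_simp
    ring
  have hYp : ∀ l, Y l (s + ε) = Y l s := by
    intro l
    refine Finset.sum_congr rfl fun j _ => ?_
    have : 2 * π * κ j / ε * (s + ε) = 2 * π * κ j / ε * s + κ j * (2 * π) := by field_simp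
    rw [this, sin_add_nat_mul_two_pi, cos_add_nat_mul_two_pi]
  have hYc : ∀ l, Continuous (Y l) := fun l =>
    continuous_iff_continuousAt.2 fun t => (hYd l t).continuousAt
  -- The primitive is shifted to vanish at `s`. The shift does not affect the second integral over a
  -- full period, because `w k` has mean zero.
  refine ⟨fun l t => Y l t - Y l s, fun k l t => ∫ r in s..t, w k r * (Y l r - Y l s),
    fun k t => (hYd k t).sub_const _, by simp, fun k l t => ?_, by simp, by simp [hYp], ?_⟩
  · have hc : Continuous fun r => w k r * (Y l r - Y l s) := by fun_prop
    exact hc.integral_hasStrictDerivAt s t |>.hasDerivAt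
  intro k l
  have h0 : ∫ r in s..s + ε, w k r = 0 := by
    rw [integral_eq_sub_of_hasDerivAt (fun t _ => hYd k t) ((hwc k).intervalIntegrable _ _), hYp,
      sub_self]
  have h1 : ∫ r in s..s + ε, w k r * (Y l r - Y l s) = ∫ r in s..s + ε, w k r * Y l r := by
    simp_rw [mul_sub]
    rw [integral_sub (f := fun r => w k r * Y l r) (g := fun r => w k r * Y l s)
      (((hwc k).mul (hYc l)).intervalIntegrable _ _)
      (((hwc k).mul continuous_const).intervalIntegrable _ _), integral_mul_const, h0]
    simp
  have h2 : ∀ r, w k r * Y l r = ∑ i, ∑ j, (2 * π * κ j / ε)⁻¹ *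
      (p k i * p l j * (sin (2 * π * κ j / ε * r) * cos (2 * π * κ i / ε * r))
        - p k i * q l j * (cos (2 * π * κ i / ε * r) * cos (2 * π * κ j / ε * r))
        + q k i * p l j * (sin (2 * π * κ i / ε * r) * sin (2 * π * κ j / ε * r))
        - q k i * q l j * (sin (2 * π * κ i / ε * r) * cos (2 * π * κ j / ε * r))) := by
    intro r
    rw [hw, hY, Finset.sum_mul_sum]
    refine Finset.sum_congr rfl fun i _ => Finset.sum_congr rfl fun j _ => ?_
    rw [div_eq_mul_inv]
    ring
  -- Orthogonality leaves the diagonal only, with factor (ε / 2πκ) · (ε / 2).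
  have h3 : ∀ i j, ∫ r in s..s + ε, (2 * π * κ j / ε)⁻¹ *
      (p k i * p l j * (sin (2 * π * κ j / ε * r) * cos (2 * π * κ i / ε * r))
        - p k i * q l j * (cos (2 * π * κ i / ε * r) * cos (2 * π * κ j / ε * r))
        + q k i * p l j * (sin (2 * π * κ i / ε * r) * sin (2 * π * κ j / ε * r))
        - q k i * q l j * (sin (2 * π * κ i / ε * r) * cos (2 * π * κ j / ε * r))) =
      if i = j then (q k j * p l j - p k j * q l j) * (ε ^ 2 / (4 * π * κ j)) else 0 := by
    intro i j
    have hI : ∀ g : ℝ → ℝ, Continuous g → IntervalIntegrable g MeasureTheory.volume s (s + ε) :=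
      fun g hg => hg.intervalIntegrable _ _
    rw [integral_const_mul, integral_sub (hI _ (by fun_prop)) (hI _ (by fun_prop)),
      integral_add (hI _ (by fun_prop)) (hI _ (by fun_prop)),
      integral_sub (hI _ (by fun_prop)) (hI _ (by fun_prop))]
    simp only [integral_const_mul, integral_sin_mul_cos _ _ _ hε,
      integral_cos_mul_cos _ _ _ hε (hκ i), integral_sin_mul_sin _ _ _ hε (hκ i)]
    have hiff : κ i = κ j ↔ i = j := hinj.eq_iff
    by_cases hij : i = j
    · subst hij
      have := hκ0 i
      simp only [if_true]
      field_simp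
      ring
    · simp [hiff, hij]
  refine h1.trans ?_
  simp_rw [h2]
  rw [integral_finsetSum fun i _ => Continuous.intervalIntegrable (by fun_prop) _ _]
  have h4 : ∀ i, ∫ r in s..s + ε, (∑ j, (2 * π * κ j / ε)⁻¹ *
      (p k i * p l j * (sin (2 * π * κ j / ε * r) * cos (2 * π * κ i / ε * r))
        - p k i * q l j * (cos (2 * π * κ i / ε * r) * cos (2 * π * κ j / ε * r))
        + q k i * p l j * (sin (2 * π * κ i / ε * r) * sin (2 * π * κ j / ε * r))
        - q k i * q l j * (sin (2 * π * κ i / ε * r) * cos (2 * π * κ j / ε * r)))) =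
      (q k i * p l i - p k i * q l i) * (ε ^ 2 / (4 * π * κ i)) := by
    intro i
    rw [integral_finsetSum fun j _ => Continuous.intervalIntegrable (by fun_prop) _ _]
    simp_rw [h3]
    simp
  simp_rw [h4]

end TrigonometricIntegrals

/-! ### Size of the controls and the averaged step -/

section Controls

variable {n m : ℕ} (S₁ : Finset (Fin m)) (S₂ : Finset (Fin m × Fin m)) (κ : Fin m × Fin m → ℕ)

/-- A constant bounding the amplitudes of the controls. -/
noncomputable def controlBound : ℝ := S₁.card + ∑ j : ↥S₂, 4 * √(Real.pi * κ j)

theorem controlBound_nonneg : 0 ≤ controlBound S₁ S₂ κ := by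
  unfold controlBound; positivity

variable {S₁ S₂ κ}

/-- Both terms can be present when `j.1 = j.2`, hence 4 in place of 2. -/
theorem abs_dither_le (ε : ℝ) (j : Fin m × Fin m) (k : Fin m) (s t : ℝ) :
    |dither κ ε j k s t| ≤ 4 * √(Real.pi * κ j) := by
  have h1 : |if k = j.1 then Real.sign s * Real.cos (2 * Real.pi * κ j / ε * t) else 0| ≤ 1 := by
    split_ifs
    · rw [abs_mul]
      have : |Real.sign s| ≤ 1 := by
        rcases Real.sign_apply_eq s with h | h | h <;> rw [h] <;> simp
      exact mul_le_one₀ this (abs_nonneg _) (Real.abs_cos_le_one _)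
    · simp
  have h2 : |if k = j.2 then Real.sin (2 * Real.pi * κ j / ε * t) else 0| ≤ 1 := by
    split_ifs
    · exact Real.abs_sin_le_one _
    · simp
  rw [dither, abs_mul, abs_of_nonneg (by positivity : (0 : ℝ) ≤ 2 * √(Real.pi * κ j))]
  nlinarith [abs_add_le (if k = j.1 then Real.sign s * Real.cos (2 * Real.pi * κ j / ε * t) else 0)
    (if k = j.2 then Real.sin (2 * Real.pi * κ j / ε * t) else 0), Real.sqrt_nonneg (Real.pi * κ j)]

/-- With `abs_oscillating_control_le`, this puts the controls on the scale q = √(ε‖a‖) required by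
`norm_sub_expansion_le`: q² for the constant part, q for the oscillating part. -/
theorem abs_constant_control_le {ε : ℝ} (hε : 0 < ε) (a : Label S₁ S₂ → ℝ) (k : Fin m) :
    |∑ i : ↥S₁, if k = i.1 then a (Sum.inl i) else 0| * ε ≤
      controlBound S₁ S₂ κ * √(ε * ‖a‖) ^ 2 := by
  rw [Real.sq_sqrt (by positivity)]
  have : |∑ i : ↥S₁, if k = i.1 then a (Sum.inl i) else 0| ≤ S₁.card * ‖a‖ := by
    refine (Finset.abs_sum_le_sum_abs _ _).trans ?_
    have : ∀ i ∈ (Finset.univ : Finset ↥S₁), |if k = i.1 then a (Sum.inl i) else 0| ≤ ‖a‖ := by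
      intro i _
      split_ifs
      · exact norm_le_pi_norm a _
      · simp
    simpa using Finset.sum_le_sum this
  calc _ ≤ S₁.card * ‖a‖ * ε := by gcongr
    _ = S₁.card * (ε * ‖a‖) := by ring
    _ ≤ _ := by
      gcongr
      rw [controlBound]
      exact le_add_of_nonneg_right (by positivity)

theorem abs_oscillating_control_le {ε : ℝ} (hε : 0 < ε) (a : Label S₁ S₂ → ℝ) (k : Fin m) (t : ℝ) :
    |(√ε)⁻¹ * ∑ j : ↥S₂, √|a (Sum.inr j)| * dither κ ε j.1 k (a (Sum.inr j)) t| * ε ≤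
      controlBound S₁ S₂ κ * √(ε * ‖a‖) := by
  have : |∑ j : ↥S₂, √|a (Sum.inr j)| * dither κ ε j.1 k (a (Sum.inr j)) t| ≤
      ∑ j : ↥S₂, √‖a‖ * (4 * √(Real.pi * κ j)) := by
    refine (Finset.abs_sum_le_sum_abs _ _).trans (Finset.sum_le_sum fun j _ => ?_)
    rw [abs_mul, abs_of_nonneg (Real.sqrt_nonneg _)]
    exact mul_le_mul (Real.sqrt_le_sqrt (norm_le_pi_norm a _)) (abs_dither_le _ _ _ _ _)
      (abs_nonneg _) (Real.sqrt_nonneg _)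
  rw [abs_mul, abs_of_nonneg (by positivity : 0 ≤ (√ε)⁻¹)]
  have hs : (√ε)⁻¹ * ε = √ε := by
    rw [inv_mul_eq_div, Real.div_sqrt]
  calc _ = (√ε)⁻¹ * ε * |∑ j : ↥S₂, √|a (Sum.inr j)| * dither κ ε j.1 k (a (Sum.inr j)) t| := by
        ring
    _ ≤ √ε * ∑ j : ↥S₂, √‖a‖ * (4 * √(Real.pi * κ j)) := by rw [hs]; gcongr
    _ = (∑ j : ↥S₂, 4 * √(Real.pi * κ j)) * √(ε * ‖a‖) := by
        rw [← Finset.mul_sum, Real.sqrt_mul hε.le]; ring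
    _ ≤ _ := by
      gcongr
      rw [controlBound]
      exact le_add_of_nonneg_left (by positivity)

theorem continuous_oscControl (ε : ℝ) (a : Label S₁ S₂ → ℝ) (k : Fin m) :
    Continuous fun t => oscControl S₁ S₂ κ ε a t k := by
  unfold oscControl dither
  refine continuous_const.add (continuous_const.mul (continuous_finsetSum _ fun j _ =>
    continuous_const.mul (continuous_const.mul (Continuous.add ?_ ?_))))
  · split_ifs <;> fun_prop
  · split_ifs <;> fun_prop

theorem abs_oscControl_le {ε : ℝ} (hε : 0 < ε) (a : Label S₁ S₂ → ℝ) (hq : √(ε * ‖a‖) ≤ 1)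
    (t : ℝ) (k : Fin m) :
    |oscControl S₁ S₂ κ ε a t k| ≤ 2 * controlBound S₁ S₂ κ * √(ε * ‖a‖) / ε := by
  have h1 := abs_constant_control_le (κ := κ) hε a k
  have h2 := abs_oscillating_control_le (κ := κ) hε a k t
  have h3 := controlBound_nonneg S₁ S₂ κ
  rw [le_div_iff₀ hε]
  have h4 : controlBound S₁ S₂ κ * √(ε * ‖a‖) ^ 2 ≤ controlBound S₁ S₂ κ * √(ε * ‖a‖) := by
    gcongr
    nlinarith [Real.sqrt_nonneg (ε * ‖a‖)]
  unfold oscControl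
  nlinarith [abs_add_le (∑ i : ↥S₁, if k = i.1 then a (Sum.inl i) else 0)
    ((√ε)⁻¹ * ∑ j : ↥S₂, √|a (Sum.inr j)| * dither κ ε j.1 k (a (Sum.inr j)) t)]

theorem bracketMap_apply (f : Fin m → State n → State n) (y : State n) (a : Label S₁ S₂ → ℝ) :
    bracketMap f S₁ S₂ y a = ∑ i : ↥S₁, a (Sum.inl i) • f i y +
      ∑ j : ↥S₂, a (Sum.inr j) • VectorField.lieBracket ℝ (f j.1.1) (f j.1.2) y := by
  simp [bracketMap, column]

/-- Over one period of the dither, the solution with frozen coefficients `a` moves, to leading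
order, by `ε 𝓕(x) a`. -/
theorem norm_sub_bracketMap_le {f : Fin m → State n → State n} {S : Set (State n)} {K : ℝ}
    (hf : FieldBounds f S K) (hK : 0 ≤ K) (hκ_pos : ∀ j ∈ S₂, 0 < κ j)
    (hκ_inj : Set.InjOn κ (S₂ : Set (Fin m × Fin m))) {ε : ℝ} (hε : 0 < ε) (s : ℝ)
    (a : Label S₁ S₂ → ℝ) (hq : √(ε * ‖a‖) ≤ 1) {x : ℝ → State n}
    (hx : ContinuousOn x (Icc s (s + ε))) (hxS : ∀ t ∈ Icc s (s + ε), x t ∈ S)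
    (hx' : ∀ t ∈ Ico s (s + ε),
      HasDerivWithinAt x (driftless f (x t) (oscControl S₁ S₂ κ ε a t) t) (Ici t) t) :
    ‖x (s + ε) - x s - ε • bracketMap f S₁ S₂ (x s) a‖ ≤
      ((m : ℝ) ^ 2 * K * controlBound S₁ S₂ κ ^ 2 *
        (2 * K + 1 + 2 * m * K * controlBound S₁ S₂ κ)) * √(ε * ‖a‖) ^ 3 := by
  set A : Fin m → ℝ := fun k => ∑ i : ↥S₁, if k = i.1 then a (Sum.inl i) else 0 with hA
  set w : Fin m → ℝ → ℝ := fun k t =>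
    (√ε)⁻¹ * ∑ j : ↥S₂, √|a (Sum.inr j)| * dither κ ε j.1 k (a (Sum.inr j)) t with hw
  set b : ↥S₂ → ℝ := fun j => (√ε)⁻¹ * √|a (Sum.inr j)| * (2 * √(Real.pi * κ j)) with hb
  obtain ⟨W, V, hW, hWs, hV, hVs, hWε, hVε⟩ := exists_iterated_integrals (ι := Fin m) (J := ↥S₂)
    (κ := fun j => κ j.1) hε
    (fun j => hκ_pos j.1 j.2) (fun i j h => Subtype.ext (hκ_inj i.2 j.2 h))
    -- The cosine acts on the first index and carries the sign; the sine acts on the second.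
    (fun k j => b j * (if k = j.1.1 then Real.sign (a (Sum.inr j)) else 0))
    (fun k j => b j * (if k = j.1.2 then 1 else 0)) s (w := w) (by
      intro k t
      simp only [hw, Finset.mul_sum]
      refine Finset.sum_congr rfl fun j _ => ?_
      simp only [dither, hb]
      split_ifs <;> ring)
  have key := norm_sub_expansion_le hf hK hε hW hWs hV hVs (controlBound_nonneg S₁ S₂ κ)
    (Real.sqrt_nonneg _) hq (A := A) (abs_constant_control_le hε a)
    (abs_oscillating_control_le hε a) hx hxS hx'
  rw [Fintype.card_fin] at key
  -- The normalisation of the controls: b² = 4πκ|a|/ε cancels the factor ε²/(4πκ) up to ε|a|, and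
  -- the sign restores a.
  have hb2 : ∀ j : ↥S₂, b j * b j * Real.sign (a (Sum.inr j)) * (ε ^ 2 / (4 * Real.pi * κ j)) =
      ε * a (Sum.inr j) := by
    intro j
    have hκj : (κ j.1 : ℝ) ≠ 0 := by have := hκ_pos j.1 j.2; positivity
    have h1 : √ε * √ε = ε := Real.mul_self_sqrt hε.le
    have h2 : √|a (Sum.inr j)| * √|a (Sum.inr j)| = |a (Sum.inr j)| :=
      Real.mul_self_sqrt (abs_nonneg _)
    have h3 : √(Real.pi * κ j) * √(Real.pi * κ j) = Real.pi * κ j :=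
      Real.mul_self_sqrt (by positivity)
    have h4 : |a (Sum.inr j)| * Real.sign (a (Sum.inr j)) = a (Sum.inr j) := by
      rcases lt_trichotomy (a (Sum.inr j)) 0 with h | h | h
      · rw [Real.sign_of_neg h, abs_of_neg h]; ring
      · simp [h]
      · rw [Real.sign_of_pos h, abs_of_pos h, mul_one]
    calc _ = (√ε * √ε)⁻¹ * (√|a (Sum.inr j)| * √|a (Sum.inr j)|) *
          (4 * (√(Real.pi * κ j) * √(Real.pi * κ j))) * Real.sign (a (Sum.inr j)) *
          (ε ^ 2 / (4 * Real.pi * κ j)) := by rw [hb]; ring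
      _ = (|a (Sum.inr j)| * Real.sign (a (Sum.inr j))) * ε := by
        rw [h1, h2, h3]; field_simp
      _ = _ := by rw [h4, mul_comm]
  have hVε' : ∀ k l, V k l (s + ε) = ∑ j : ↥S₂, ε * a (Sum.inr j) *
      ((if k = j.1.2 then 1 else 0) * (if l = j.1.1 then 1 else 0) -
        (if k = j.1.1 then 1 else 0) * (if l = j.1.2 then 1 else 0)) := by
    intro k l
    rw [hVε]
    refine Finset.sum_congr rfl fun j _ => ?_
    rw [← hb2 j]
    split_ifs <;> ring
  -- Antisymmetry in k and l assembles the iterated derivatives into Df_{j₂} f_{j₁} - Df_{j₁}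
  -- f_{j₂}.
  have hsum2 : ∑ k, ∑ l, V k l (s + ε) • fderiv ℝ (f k) (x s) (f l (x s)) =
      ε • ∑ j : ↥S₂, a (Sum.inr j) • VectorField.lieBracket ℝ (f j.1.1) (f j.1.2) (x s) := by
    simp_rw [hVε', Finset.sum_smul]
    simp_rw [Finset.sum_comm (s := (Finset.univ : Finset (Fin m))) (t := (Finset.univ : Finset ↥S₂))]
    rw [Finset.smul_sum]
    refine Finset.sum_congr rfl fun j _ => ?_
    simp only [mul_smul, ← Finset.smul_sum, sub_smul, Finset.sum_sub_distrib, ite_smul, one_smul,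
      zero_smul, Finset.sum_ite_irrel, Finset.sum_const_zero, Finset.sum_ite_eq', Finset.mem_univ, if_true, VectorField.lieBracket]
  have hsum1 : ∑ k, A k • f k (x s) = ∑ i : ↥S₁, a (Sum.inl i) • f i (x s) := by
    simp_rw [hA, Finset.sum_smul]
    rw [Finset.sum_comm]
    simp
  have e : x (s + ε) - x s - ε • bracketMap f S₁ S₂ (x s) a =
      x (s + ε) - x s - ε • ∑ k, A k • f k (x s) - ∑ k, W k (s + ε) • f k (x s) -
        ∑ k, ∑ l, V k l (s + ε) • fderiv ℝ (f k) (x s) (f l (x s)) := by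
    rw [hsum1, hsum2, bracketMap_apply, smul_add]
    simp only [hWε, zero_smul, Finset.sum_const_zero]
    abel
  rw [e]
  exact key

end Controls

/-! ### Uniform bounds near the equilibrium -/

section LocalBounds

theorem exists_bound_lipschitz_closedBall {E G : Type*} [NormedAddCommGroup E] [NormedSpace ℝ E]
    [NormedAddCommGroup G] [NormedSpace ℝ G] {h : E → G} {x₀ : E} (hh : ContDiffAt ℝ 1 h x₀) :
    ∃ K : ℝ, 0 ≤ K ∧ ∃ R > 0, (∀ x ∈ Metric.closedBall x₀ R, ‖h x‖ ≤ K) ∧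
      ∀ x ∈ Metric.closedBall x₀ R, ∀ y ∈ Metric.closedBall x₀ R, ‖h x - h y‖ ≤ K * ‖x - y‖ := by
  obtain ⟨K, t, ht, hK⟩ := hh.exists_lipschitzOnWith
  have h1 : ∀ᶠ x in 𝓝 x₀, ‖h x‖ < ‖h x₀‖ + 1 :=
    hh.continuousAt.norm.eventually_lt continuousAt_const (by simp)
  obtain ⟨R, hR, hRt⟩ := Metric.nhds_basis_closedBall.mem_iff.1 (Filter.inter_mem ht h1)
  refine ⟨max K (‖h x₀‖ + 1), le_max_of_le_left K.2, R, hR,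
    fun x hx => (le_of_lt (hRt hx).2).trans (le_max_right _ _), fun x hx y hy => ?_⟩
  refine (hK.norm_sub_le (hRt hx).1 (hRt hy).1).trans ?_
  gcongr
  exact le_max_left _ _

theorem FieldBounds.mono {E ι : Type*} [NormedAddCommGroup E] [NormedSpace ℝ E] [Fintype ι]
    {f : ι → E → E} {S S' : Set E} {K : ℝ} (h : FieldBounds f S K) (hS : S' ⊆ S) :
    FieldBounds f S' K where
  differentiableAt k x hx := h.differentiableAt k x (hS hx)
  norm_le k x hx := h.norm_le k x (hS hx)
  lipschitz k x hx y hy := h.lipschitz k x (hS hx) y (hS hy)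
  norm_fderiv_le k l x hx := h.norm_fderiv_le k l x (hS hx)
  lipschitz_fderiv k l x hx y hy := h.lipschitz_fderiv k l x (hS hx) y (hS hy)

/-- Since the fields are C², the maps Df_k f_l are still C¹, hence locally Lipschitz. Viewing each
finite family as one map into a product gives constants uniform in the indices. -/
theorem exists_fieldBounds {E ι : Type*} [NormedAddCommGroup E] [NormedSpace ℝ E] [Fintype ι]
    {f : ι → E → E} {D : Set E} (hD : IsOpen D) (hf : ∀ k, ContDiffOn ℝ 2 (f k) D) {x₀ : E}
    (hx₀ : x₀ ∈ D) :
    ∃ K : ℝ, 0 ≤ K ∧ ∃ R > 0, FieldBounds f (Metric.closedBall x₀ R) K := by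
  have hfa : ∀ k, ContDiffAt ℝ 2 (f k) x₀ := fun k => (hf k).contDiffAt (hD.mem_nhds hx₀)
  have h1 : ContDiffAt ℝ 1 (fun x k => f k x) x₀ :=
    contDiffAt_pi.2 fun k => (hfa k).of_le (by norm_num)
  have h2 : ContDiffAt ℝ 1 (fun x (p : ι × ι) => fderiv ℝ (f p.1) x (f p.2 x)) x₀ :=
    contDiffAt_pi.2 fun p => ((hfa p.1).fderiv_right (by norm_num)).clm_apply
      ((hfa p.2).of_le (by norm_num))
  obtain ⟨K₁, hK₁, R₁, hR₁, hb₁, hl₁⟩ := exists_bound_lipschitz_closedBall h1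
  obtain ⟨K₂, hK₂, R₂, hR₂, hb₂, hl₂⟩ := exists_bound_lipschitz_closedBall h2
  obtain ⟨R₃, hR₃, hRD⟩ := Metric.nhds_basis_closedBall.mem_iff.1 (hD.mem_nhds hx₀)
  have s1 : Metric.closedBall x₀ (min R₁ (min R₂ R₃)) ⊆ Metric.closedBall x₀ R₁ :=
    Metric.closedBall_subset_closedBall (min_le_left _ _)
  have s2 : Metric.closedBall x₀ (min R₁ (min R₂ R₃)) ⊆ Metric.closedBall x₀ R₂ :=
    Metric.closedBall_subset_closedBall ((min_le_right _ _).trans (min_le_left _ _))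
  have s3 : Metric.closedBall x₀ (min R₁ (min R₂ R₃)) ⊆ Metric.closedBall x₀ R₃ :=
    Metric.closedBall_subset_closedBall ((min_le_right _ _).trans (min_le_right _ _))
  refine ⟨max K₁ K₂, le_max_of_le_left hK₁, min R₁ (min R₂ R₃), by positivity, ?_, ?_, ?_, ?_, ?_⟩
  · intro k x hx
    exact ((hf k).contDiffAt (hD.mem_nhds (hRD (s3 hx)))).differentiableAt (by norm_num)
  · intro k x hx
    exact (norm_le_pi_norm (fun k => f k x) k).trans ((hb₁ x (s1 hx)).trans (le_max_left _ _))
  · intro k x hx y hy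
    refine (norm_le_pi_norm ((fun k => f k x) - fun k => f k y) k).trans
      ((hl₁ x (s1 hx) y (s1 hy)).trans ?_)
    gcongr
    exact le_max_left _ _
  · intro k l x hx
    exact (norm_le_pi_norm (fun p : ι × ι => fderiv ℝ (f p.1) x (f p.2 x)) (k, l)).trans
      ((hb₂ x (s2 hx)).trans (le_max_right _ _))
  · intro k l x hx y hy
    refine (norm_le_pi_norm ((fun p : ι × ι => fderiv ℝ (f p.1) x (f p.2 x)) -
      fun p : ι × ι => fderiv ℝ (f p.1) y (f p.2 y)) (k, l)).trans
      ((hl₂ x (s2 hx) y (s2 hy)).trans ?_)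
    gcongr
    exact le_max_right _ _

theorem contDiffAt_gradient {F : Type*} [NormedAddCommGroup F] [InnerProductSpace ℝ F]
    [CompleteSpace F] {P : F → ℝ} {x₀ : F} (hP : ContDiffAt ℝ 2 P x₀) :
    ContDiffAt ℝ 1 (gradient P) x₀ :=
  ((InnerProductSpace.toDual ℝ F).symm.contDiff.contDiffAt).comp x₀
    (hP.fderiv_right (by norm_num))

/-- First order Taylor estimate for a function whose gradient is `G`-Lipschitz on a ball. -/
theorem sub_le_inner_gradient_add {F : Type*} [NormedAddCommGroup F] [InnerProductSpace ℝ F]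
    [CompleteSpace F] {P : F → ℝ} {x₀ : F} {R G : ℝ} (hG : 0 ≤ G)
    (hd : ∀ x ∈ Metric.closedBall x₀ R, DifferentiableAt ℝ P x)
    (hl : ∀ x ∈ Metric.closedBall x₀ R, ∀ y ∈ Metric.closedBall x₀ R,
      ‖gradient P x - gradient P y‖ ≤ G * ‖x - y‖)
    {y z : F} (hy : y ∈ Metric.closedBall x₀ R) (hz : z ∈ Metric.closedBall x₀ R) :
    P z - P y ≤ inner ℝ (gradient P y) (z - y) + G * ‖z - y‖ ^ 2 := by
  -- On this intersection the derivative differs from that at y by at most G‖z - y‖. The mean value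
  -- inequality then gives G where integration would give G/2.
  have := ((convex_closedBall x₀ R).inter (convex_closedBall y ‖z - y‖)
    ).norm_image_sub_le_of_norm_fderiv_le' (f := P) (φ := fderiv ℝ P y) (C := G * ‖z - y‖)
    (x := y) (y := z) (fun x hx => hd x hx.1) (fun x hx => ?_) ⟨hy, by simp⟩
    ⟨hz, by simp [dist_eq_norm]⟩
  · rw [inner_gradient_left]
    have h := (le_abs_self _).trans this
    nlinarith
  · have h1 : ‖fderiv ℝ P x - fderiv ℝ P y‖ = ‖gradient P x - gradient P y‖ := by
      rw [gradient, gradient, ← map_sub, LinearIsometryEquiv.norm_map]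
    rw [h1]
    refine (hl x hx.1 y hy).trans ?_
    gcongr
    simpa [dist_eq_norm] using hx.2

variable {n m : ℕ} {D : Set (State n)} {f : Fin m → State n → State n} {S₁ : Finset (Fin m)}
  {S₂ : Finset (Fin m × Fin m)}

/-- The columns span, so the map is onto; their number is n, so it is bijective. -/
theorem IsBracketGenerating.isInvertible (hS : IsBracketGenerating f D S₁ S₂) {x : State n}
    (hx : x ∈ D) : (bracketMap f S₁ S₂ x).IsInvertible := by
  have hsurj : Function.Surjective (bracketMap f S₁ S₂ x).toLinearMap := by
    rw [← LinearMap.range_eq_top, eq_top_iff, ← hS.span_eq x hx, Submodule.span_le]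
    rintro _ ⟨l, rfl⟩
    refine ⟨Pi.single l 1, ?_⟩
    simp [bracketMap, Pi.single_apply, ite_smul, -Fintype.sum_sum_type]
  have hfin : Module.finrank ℝ (Label S₁ S₂ → ℝ) = Module.finrank ℝ (State n) := by
    simp [hS.card_eq]
  have hinj := (LinearMap.injective_iff_surjective_of_finrank_eq_finrank hfin).2 hsurj
  exact ⟨(LinearEquiv.ofBijective (bracketMap f S₁ S₂ x).toLinearMap
    ⟨hinj, hsurj⟩).toContinuousLinearEquiv, by ext; rfl⟩

theorem continuousAt_bracketMap {x : State n} (hf : ∀ k, ContDiffAt ℝ 2 (f k) x) :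
    ContinuousAt (bracketMap f S₁ S₂) x := by
  unfold bracketMap
  have hcol : ∀ l, ContinuousAt (fun x => column f S₁ S₂ x l) x := by
    rintro (i | j)
    · exact (hf _).continuousAt
    · exact ((hf _).lieBracket_vectorField (m := 1) (hf _) (by norm_num)).continuousAt
  refine tendsto_finsetSum _ fun l _ => ?_
  exact ((ContinuousLinearMap.smulRightL ℝ (Label S₁ S₂ → ℝ) (State n)
    (ContinuousLinearMap.proj l)).continuous.continuousAt).comp (hcol l)

theorem bracketMap_coeff (hS : IsBracketGenerating f D S₁ S₂) (P : State n → ℝ) (γ : ℝ)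
    {x : State n} (hx : x ∈ D) :
    bracketMap f S₁ S₂ x (coeff f S₁ S₂ P γ x) = -γ • gradient P x := by
  rw [coeff, map_smul, (hS.isInvertible hx).self_apply_inverse]

/-- Inversion is continuous at an invertible map, so 𝓕⁻¹ is bounded near `x₀`. This is what makes
the expansion error relative to the gradient. -/
theorem exists_norm_coeff_le (hS : IsBracketGenerating f D S₁ S₂) (hD : IsOpen D)
    (hf : ∀ k, ContDiffOn ℝ 2 (f k) D) {x₀ : State n} (hx₀ : x₀ ∈ D) (P : State n → ℝ) (γ : ℝ) :
    ∃ C : ℝ, 0 ≤ C ∧ ∃ R > 0, ∀ x ∈ Metric.closedBall x₀ R,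
      ‖coeff f S₁ S₂ P γ x‖ ≤ C * ‖gradient P x‖ := by
  have h1 : ContinuousAt (fun x => (bracketMap f S₁ S₂ x).inverse) x₀ :=
    ContinuousAt.comp
      ((hS.isInvertible hx₀).contDiffAt_map_inverse (𝕜 := ℝ) (n := 0)).continuousAt
      (continuousAt_bracketMap fun k => (hf k).contDiffAt (hD.mem_nhds hx₀))
  have h2 := h1.norm.eventually_lt (continuousAt_const (y := ‖(bracketMap f S₁ S₂ x₀).inverse‖ + 1))
    (by simp)
  obtain ⟨R, hR, hRt⟩ := Metric.nhds_basis_closedBall.mem_iff.1 h2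
  refine ⟨|γ| * (‖(bracketMap f S₁ S₂ x₀).inverse‖ + 1), by positivity, R, hR, fun x hx => ?_⟩
  rw [coeff, norm_smul, norm_neg, Real.norm_eq_abs, mul_assoc]
  gcongr
  refine (ContinuousLinearMap.le_opNorm _ _).trans ?_
  gcongr
  exact (hRt hx).le

end LocalBounds

/-! ### Existence, confinement and descent over one period -/

section Period

variable {n m : ℕ} {D : Set (State n)} {f : Fin m → State n → State n} {S₁ : Finset (Fin m)}
  {S₂ : Finset (Fin m × Fin m)} {κ : Fin m × Fin m → ℕ}

/-- `x` solves the driftless system on `[s, s + ε)`, with the oscillating controls with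
coefficients `a`. -/
structure IsPeriodSolution (f : Fin m → State n → State n) (S₁ : Finset (Fin m))
    (S₂ : Finset (Fin m × Fin m)) (κ : Fin m × Fin m → ℕ) (ε : ℝ) (a : Label S₁ S₂ → ℝ)
    (s : ℝ) (x : ℝ → State n) : Prop where
  continuousOn : ContinuousOn x (Icc s (s + ε))
  hasDerivWithinAt : ∀ t ∈ Ico s (s + ε),
    HasDerivWithinAt x (driftless f (x t) (oscControl S₁ S₂ κ ε a t) t) (Ici t) t

theorem norm_driftless_le {S : Set (State n)} {K : ℝ} (hf : FieldBounds f S K) {ε : ℝ}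
    (hε : 0 < ε) (a : Label S₁ S₂ → ℝ) (hq : √(ε * ‖a‖) ≤ 1) (t : ℝ) {y : State n} (hy : y ∈ S) :
    ‖driftless f y (oscControl S₁ S₂ κ ε a t) t‖ ≤
      2 * m * K * controlBound S₁ S₂ κ * √(ε * ‖a‖) / ε := by
  have h0 := controlBound_nonneg S₁ S₂ κ
  have := norm_sum_smul_le (by positivity) (abs_oscControl_le (κ := κ) hε a hq t)
    (fun k => hf.norm_le k y hy)
  rw [Fintype.card_fin] at this
  refine this.trans_eq ?_
  ring

/-- The speed bound confines a solution over one period. -/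
theorem IsPeriodSolution.norm_sub_le {ε : ℝ} {a : Label S₁ S₂ → ℝ} {s : ℝ} {x : ℝ → State n}
    (hx : IsPeriodSolution f S₁ S₂ κ ε a s x) {S : Set (State n)} {K : ℝ}
    (hf : FieldBounds f S K) (hK : 0 ≤ K) (hε : 0 < ε) (hq : √(ε * ‖a‖) ≤ 1) {ρ : ℝ}
    (hρ : Metric.closedBall (x s) ρ ⊆ S)
    (hlt : 2 * m * K * controlBound S₁ S₂ κ * √(ε * ‖a‖) < ρ) {t : ℝ} (ht : t ∈ Icc s (s + ε)) :
    ‖x t - x s‖ ≤ 2 * m * K * controlBound S₁ S₂ κ * √(ε * ‖a‖) := by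
  have h0 := controlBound_nonneg S₁ S₂ κ
  set b := 2 * m * K * controlBound S₁ S₂ κ * √(ε * ‖a‖) with hb
  have hb0 : 0 ≤ b := by positivity
  have h1 := norm_sub_le_of_speed_le_on_closedBall (B := b / ε) (ρ := ρ) (by positivity) hε
    hx.continuousOn hx.hasDerivWithinAt
    (fun t _ hmem => norm_driftless_le hf hε a hq t (hρ hmem))
    (by rwa [div_mul_cancel₀ _ hε.ne']) t ht
  refine h1.trans ?_
  have : b / ε * (t - s) ≤ b / ε * ε := by
    gcongr
    linarith [ht.2]
  rwa [div_mul_cancel₀ _ hε.ne'] at this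

/-- Picard–Lindelöf on the ball of radius ρ: the speed there is at most b/ε, so during time ε the
solution travels at most b < ρ. As K bounds both the fields and their Lipschitz constants, b/ε is
also a Lipschitz constant. -/
theorem exists_periodSolution {S : Set (State n)} {K : ℝ} (hf : FieldBounds f S K) (hK : 0 ≤ K)
    {ε : ℝ} (hε : 0 < ε) (a : Label S₁ S₂ → ℝ) (hq : √(ε * ‖a‖) ≤ 1) (s : ℝ) (y : State n)
    {ρ : ℝ} (hρ : Metric.closedBall y ρ ⊆ S)
    (hlt : 2 * m * K * controlBound S₁ S₂ κ * √(ε * ‖a‖) < ρ) :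
    ∃ x : ℝ → State n, x s = y ∧ ∀ t ∈ Icc s (s + ε),
      HasDerivWithinAt x (driftless f (x t) (oscControl S₁ S₂ κ ε a t) t) (Icc s (s + ε)) t := by
  have h0 := controlBound_nonneg S₁ S₂ κ
  set b := 2 * m * K * controlBound S₁ S₂ κ * √(ε * ‖a‖) with hb
  have hb0 : 0 ≤ b := by positivity
  have hpl : IsPicardLindelof (fun t z => driftless f z (oscControl S₁ S₂ κ ε a t) t)
      (tmin := s) (tmax := s + ε) ⟨s, le_rfl, by linarith⟩ y (.mk ρ (hb0.trans hlt.le)) 0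
      (.mk (b / ε) (by positivity)) (.mk (b / ε) (by positivity)) := by
    refine ⟨fun t _ => ?_, fun z _ => ?_, fun t _ z hz => ?_, ?_⟩
    · refine LipschitzOnWith.of_dist_le_mul fun z hz z' hz' => ?_
      have := norm_sum_smul_le (by positivity) (abs_oscControl_le (κ := κ) hε a hq t)
        (fun k => hf.lipschitz k z (hρ hz) z' (hρ hz'))
      rw [dist_eq_norm, dist_eq_norm, driftless, driftless, ← Finset.sum_sub_distrib]
      simp_rw [← smul_sub]
      refine this.trans_eq ?_
      rw [Fintype.card_fin, NNReal.coe_mk, hb]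
      ring
    · unfold driftless
      exact (continuous_finsetSum _ fun k _ =>
        (continuous_oscControl ε a k).smul continuous_const).continuousOn
    · exact norm_driftless_le hf hε a hq t (hρ hz)
    · simp only [add_sub_cancel_left, sub_self, NNReal.coe_zero, sub_zero, NNReal.coe_mk]
      rw [max_eq_left hε.le, div_mul_cancel₀ _ hε.ne']
      exact hlt.le
  exact hpl.exists_eq_forall_mem_Icc_hasDerivWithinAt₀

/-- A perturbed gradient step decreases the quadratic upper bound of a function. -/
theorem inner_add_norm_sq_le_of_perturbed_step {F : Type*} [NormedAddCommGroup F]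
    [InnerProductSpace ℝ F] {p v : F} {ε γ C G q : ℝ} (hε : 0 ≤ ε) (hγ : 0 ≤ γ) (hC : 0 ≤ C)
    (hG : 0 ≤ G) (hq1 : q ≤ 1)
    (hr : ‖v - ε • (-γ • p)‖ ≤ C * q * (ε * ‖p‖))
    (hsmall : C * q + G * (γ + C) ^ 2 * ε ≤ γ / 2) :
    inner ℝ p v + G * ‖v‖ ^ 2 ≤ -(γ / 2 * ε * ‖p‖ ^ 2) := by
  set r := v - ε • (-γ • p) with hr_def
  have hv : v = -(ε * γ) • p + r := by
    rw [hr_def, smul_smul]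
    simp
  have hr' : ‖r‖ ≤ C * (ε * ‖p‖) := by
    refine hr.trans ?_
    have : C * q ≤ C * 1 := by gcongr
    rw [mul_one] at this
    gcongr
  have hvn : ‖v‖ ≤ (γ + C) * (ε * ‖p‖) := by
    rw [hv]
    refine (norm_add_le _ _).trans ?_
    rw [norm_smul, norm_neg, Real.norm_eq_abs, abs_of_nonneg (by positivity)]
    linarith
  have hin : inner ℝ p v ≤ -(ε * γ) * ‖p‖ ^ 2 + ‖p‖ * (C * q * (ε * ‖p‖)) := by
    rw [hv, inner_add_right, inner_smul_right, real_inner_self_eq_norm_sq]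
    gcongr
    exact (real_inner_le_norm _ _).trans (by gcongr)
  have hsq : G * ‖v‖ ^ 2 ≤ G * ((γ + C) * (ε * ‖p‖)) ^ 2 := by gcongr
  -- The step error and the second order Taylor term together consume at most half of the ideal
  -- decrease γε‖p‖².
  have : (C * q + G * (γ + C) ^ 2 * ε) * (ε * ‖p‖ ^ 2) ≤ γ / 2 * (ε * ‖p‖ ^ 2) := by gcongr
  linarith

/-- Behaviour over one sampling period, for starting points in the ball of radius `R` around `xs`:
solutions exist, stay near their starting point, and decrease `P`. -/
structure HasPeriodDescent (f : Fin m → State n → State n) (S₁ : Finset (Fin m))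
    (S₂ : Finset (Fin m × Fin m)) (κ : Fin m × Fin m → ℕ) (P : State n → ℝ) (γ ε : ℝ)
    (xs : State n) (R c : ℝ) : Prop where
  sqrt_le_one : ∀ y ∈ Metric.closedBall xs R, √(ε * ‖coeff f S₁ S₂ P γ y‖) ≤ 1
  exists_solution : ∀ y ∈ Metric.closedBall xs R, ∀ s, ∃ x : ℝ → State n, x s = y ∧
    ∀ t ∈ Icc s (s + ε), HasDerivWithinAt x
      (driftless f (x t) (oscControl S₁ S₂ κ ε (coeff f S₁ S₂ P γ y) t) t) (Icc s (s + ε)) t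
  mem : ∀ s x, x s ∈ Metric.closedBall xs R →
    IsPeriodSolution f S₁ S₂ κ ε (coeff f S₁ S₂ P γ (x s)) s x →
    ∀ t ∈ Icc s (s + ε), x t ∈ Metric.closedBall xs (2 * R)
  norm_sub_le : ∀ s x, x s ∈ Metric.closedBall xs R →
    IsPeriodSolution f S₁ S₂ κ ε (coeff f S₁ S₂ P γ (x s)) s x →
    ∀ t ∈ Icc s (s + ε), ‖x t - x s‖ ≤ c * √‖gradient P (x s)‖
  descent : ∀ s x, x s ∈ Metric.closedBall xs R →
    IsPeriodSolution f S₁ S₂ κ ε (coeff f S₁ S₂ P γ (x s)) s x →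
    P (x (s + ε)) ≤ P (x s) - γ / 2 * ε * ‖gradient P (x s)‖ ^ 2

theorem exists_period_descent (hD : IsOpen D) (hf : ∀ k, ContDiffOn ℝ 2 (f k) D)
    (hS : IsBracketGenerating f D S₁ S₂) (hκ_pos : ∀ j ∈ S₂, 0 < κ j)
    (hκ_inj : Set.InjOn κ (S₂ : Set (Fin m × Fin m))) {xs : State n} (hxs : xs ∈ D)
    {P : State n → ℝ} (hP : ContDiffOn ℝ 2 P D) {γ : ℝ} (hγ : 0 < γ) :
    ∃ R > 0, Metric.closedBall xs (2 * R) ⊆ D ∧ ∃ K : ℝ, 0 ≤ K ∧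
      FieldBounds f (Metric.closedBall xs (2 * R)) K ∧ ∃ c : ℝ, 0 ≤ c ∧ ∃ εbar > 0, ∀ ε : ℝ,
      0 < ε → ε < εbar → HasPeriodDescent f S₁ S₂ κ P γ ε xs R c := by
  obtain ⟨K, hK, R₁, hR₁, hfb⟩ := exists_fieldBounds hD hf hxs
  obtain ⟨A, hA, R₂, hR₂, hA'⟩ := exists_norm_coeff_le hS hD hf hxs P γ
  obtain ⟨G, hG, R₃, hR₃, hGb, hGl⟩ := exists_bound_lipschitz_closedBall
    (contDiffAt_gradient (hP.contDiffAt (hD.mem_nhds hxs)))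
  obtain ⟨R₄, hR₄, hRD⟩ := Metric.nhds_basis_closedBall.mem_iff.1 (hD.mem_nhds hxs)
  obtain ⟨R, hR, hr1, hr2, hr3, hr4⟩ : ∃ R > 0, 2 * R ≤ R₁ ∧ 2 * R ≤ R₂ ∧ 2 * R ≤ R₃ ∧
      2 * R ≤ R₄ := by
    refine ⟨min (min R₁ R₂) (min R₃ R₄) / 2, by positivity, ?_, ?_, ?_, ?_⟩ <;>
    · rw [mul_div_cancel₀ _ two_ne_zero]
      simp
  have hball : ∀ y ∈ Metric.closedBall xs R,
      Metric.closedBall y R ⊆ Metric.closedBall xs (2 * R) := by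
    intro y hy
    refine Metric.closedBall_subset_closedBall' ?_
    linarith [Metric.mem_closedBall.1 hy]
  have hsub : Metric.closedBall xs R ⊆ Metric.closedBall xs (2 * R) :=
    Metric.closedBall_subset_closedBall (by linarith)
  have hfb' := hfb.mono (Metric.closedBall_subset_closedBall hr1)
  have hRD' : Metric.closedBall xs (2 * R) ⊆ D :=
    (Metric.closedBall_subset_closedBall hr4).trans hRD
  have hb0 := controlBound_nonneg S₁ S₂ κ
  set b := 2 * m * K * controlBound S₁ S₂ κ with hb
  set C := (m : ℝ) ^ 2 * K * controlBound S₁ S₂ κ ^ 2 *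
    (2 * K + 1 + 2 * m * K * controlBound S₁ S₂ κ) with hC
  have hbnn : 0 ≤ b := by positivity
  have hCnn : 0 ≤ C := by positivity
  -- √(εAG) is the largest value of q on the ball, so smallness conditions stated for it hold for
  -- all starting points at once.
  have hsmall : ∀ᶠ ε in 𝓝 (0 : ℝ), ε < 1 ∧ √(ε * (A * G)) < 1 ∧ b * √(ε * (A * G)) < R ∧
      C * A * √(ε * (A * G)) + G * (γ + C * A) ^ 2 * ε < γ / 2 := by
    have h1 : Filter.Tendsto (fun ε => √(ε * (A * G))) (𝓝 0) (𝓝 0) := by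
      have : Continuous fun ε => √(ε * (A * G)) := by fun_prop
      simpa using this.tendsto 0
    have h2 : Filter.Tendsto (fun ε => b * √(ε * (A * G))) (𝓝 0) (𝓝 0) := by
      simpa using h1.const_mul b
    have h3 : Filter.Tendsto (fun ε => C * A * √(ε * (A * G)) + G * (γ + C * A) ^ 2 * ε)
        (𝓝 0) (𝓝 0) := by
      simpa using (h1.const_mul (C * A)).add (Filter.tendsto_id.const_mul (G * (γ + C * A) ^ 2))
    exact (eventually_lt_nhds one_pos).and ((h1.eventually_lt_const one_pos).and
      ((h2.eventually_lt_const hR).and (h3.eventually_lt_const (by positivity))))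
  obtain ⟨εbar, hεbar, hsmall⟩ := Metric.eventually_nhds_iff.1 hsmall
  refine ⟨R, hR, hRD', K, hK, hfb', b * √A, by positivity, εbar, hεbar, fun ε hε hεlt => ?_⟩
  suffices H : ∀ y ∈ Metric.closedBall xs R,
        √(ε * ‖coeff f S₁ S₂ P γ y‖) ≤ 1 ∧
        (∀ s, ∃ x : ℝ → State n, x s = y ∧ ∀ t ∈ Icc s (s + ε), HasDerivWithinAt x
          (driftless f (x t) (oscControl S₁ S₂ κ ε (coeff f S₁ S₂ P γ y) t) t)
          (Icc s (s + ε)) t) ∧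
        ∀ s x, x s = y → IsPeriodSolution f S₁ S₂ κ ε (coeff f S₁ S₂ P γ y) s x →
          (∀ t ∈ Icc s (s + ε), x t ∈ Metric.closedBall xs (2 * R) ∧
            ‖x t - y‖ ≤ b * √A * √‖gradient P y‖) ∧
          P (x (s + ε)) ≤ P y - γ / 2 * ε * ‖gradient P y‖ ^ 2 from
    ⟨fun y hy => (H y hy).1, fun y hy => (H y hy).2.1,
      fun s x hy hx t ht => (((H _ hy).2.2 s x rfl hx).1 t ht).1,
      fun s x hy hx t ht => (((H _ hy).2.2 s x rfl hx).1 t ht).2,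
      fun s x hy hx => ((H _ hy).2.2 s x rfl hx).2⟩
  intro y hy
  obtain ⟨hs0, hs1, hs2, hs3⟩ := hsmall (y := ε) (by simpa [abs_of_pos hε] using hεlt)
  set a := coeff f S₁ S₂ P γ y with ha
  set g := ‖gradient P y‖ with hg
  set q := √(ε * ‖a‖) with hq
  have hg0 : 0 ≤ g := norm_nonneg _
  have hq0 : 0 ≤ q := Real.sqrt_nonneg _
  have haA : ‖a‖ ≤ A * g := hA' y (Metric.closedBall_subset_closedBall hr2 (hsub hy))
  have hgG : g ≤ G := hGb y (Metric.closedBall_subset_closedBall hr3 (hsub hy))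
  have hqle : q ≤ √(ε * (A * G)) := by
    refine Real.sqrt_le_sqrt ?_
    gcongr
    exact haA.trans (by gcongr)
  have hq1 : q ≤ 1 := hqle.trans hs1.le
  have hbq : b * q < R := lt_of_le_of_lt (by gcongr) hs2
  refine ⟨hq1, fun s => exists_periodSolution hfb' hK hε a hq1 s y (hball y hy) hbq,
    fun s x hxs' hx => ?_⟩
  have hdisp : ∀ t ∈ Icc s (s + ε), ‖x t - y‖ ≤ b * q := by
    intro t ht
    have := hx.norm_sub_le hfb' hK hε hq1 (by rw [hxs']; exact hball y hy) hbq ht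
    rwa [hxs'] at this
  have hmem : ∀ t ∈ Icc s (s + ε), x t ∈ Metric.closedBall xs (2 * R) := fun t ht =>
    hball y hy (mem_closedBall_iff_norm.2 ((hdisp t ht).trans hbq.le))
  have hq2 : q ^ 2 ≤ ε * (A * g) := by
    rw [hq, Real.sq_sqrt (by positivity)]
    gcongr
  have hexp := norm_sub_bracketMap_le hfb' hK hκ_pos hκ_inj hε s a hq1 hx.continuousOn hmem
    hx.hasDerivWithinAt
  rw [hxs', ha, bracketMap_coeff hS P γ (hRD' (hsub hy)), ← ha, ← hC, ← hq] at hexp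
  clear_value b C a q
  refine ⟨fun t ht => ⟨hmem t ht, (hdisp t ht).trans ?_⟩, ?_⟩
  -- Since ε < 1, it can be dropped from q² ≤ εAg; the constant `b * √A` is thus independent of ε.
  · rw [mul_assoc b, ← Real.sqrt_mul hA]
    gcongr
    refine Real.le_sqrt_of_sq_le (hq2.trans ?_)
    nlinarith [mul_nonneg hA hg0]
  have hzmem : x (s + ε) ∈ Metric.closedBall xs (2 * R) := hmem _ ⟨by linarith, le_rfl⟩
  have hT := sub_le_inner_gradient_add (P := P) hG
    (fun w hw => (hP.contDiffAt (hD.mem_nhds (hRD' hw))).differentiableAt (by norm_num))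
    (fun w hw w' hw' => hGl w (Metric.closedBall_subset_closedBall hr3 hw) w'
      (Metric.closedBall_subset_closedBall hr3 hw')) (hsub hy) hzmem
  -- Two of the three powers of q become ε times the gradient; the third remains as the small
  -- relative factor.
  have hrle : ‖x (s + ε) - y - ε • (-γ • gradient P y)‖ ≤ C * A * q * (ε * g) := by
    refine hexp.trans ?_
    calc C * q ^ 3 = C * q * q ^ 2 := by ring
      _ ≤ C * q * (ε * (A * g)) := by gcongr
      _ = _ := by ring
  have hfin : C * A * q + G * (γ + C * A) ^ 2 * ε ≤ γ / 2 := by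
    refine le_trans ?_ hs3.le
    gcongr
  have := inner_add_norm_sq_le_of_perturbed_step hε.le hγ.le (by positivity) hG hq1 hrle hfin
  linarith

end Period

/-! ### Trapping sets, stability and attraction -/

section Iteration

variable {n m : ℕ} {D : Set (State n)} {f : Fin m → State n → State n} {S₁ : Finset (Fin m)}
  {S₂ : Finset (Fin m × Fin m)} {κ : Fin m × Fin m → ℕ} {P : State n → ℝ} {γ ε : ℝ}
  {xs : State n}

theorem IsClosedLoopSolution.isPeriodSolution (hε : 0 < ε) {t₀ : ℝ} {x₀ : State n}
    {x : ℝ → State n} (hx : IsClosedLoopSolution D f S₁ S₂ κ P γ ε t₀ x₀ x) (j : ℕ) :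
    IsPeriodSolution f S₁ S₂ κ ε (coeff f S₁ S₂ P γ (x (t₀ + ε * j))) (t₀ + ε * j) x := by
  have hτ : t₀ + ε * (j + 1) = t₀ + ε * j + ε := by ring
  have hj : t₀ ≤ t₀ + ε * j := by
    have : 0 ≤ ε * j := by positivity
    linarith
  refine ⟨?_, fun t ht => ?_⟩
  · refine (hx.absCont (t₀ + ε * j + ε) (by linarith)).continuousOn.mono ?_
    rw [uIcc_of_le (by linarith)]
    exact Icc_subset_Icc_left hj
  · rw [← hτ] at ht
    exact (hx.ode j t ht).mono_of_mem_nhdsWithin (Ico_mem_nhdsGE_of_mem ht)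

/-- The part of the closed ball of radius `ρ` around `xs` where `P - mP` is at most `w ρ`. -/
def trappingSet (P : State n → ℝ) (mP : ℝ) (w : ℝ → ℝ) (xs : State n) (ρ : ℝ) : Set (State n) :=
  {y | y ∈ Metric.closedBall xs ρ ∧ P y - mP ≤ w ρ}

variable {mP : ℝ} {w : ℝ → ℝ} {R c : ℝ}

theorem exists_ball_subset_trappingSet (hw : IsClassK w) (hP : ContinuousAt P xs)
    (hPxs : P xs = mP) {ρ : ℝ} (hρ : 0 < ρ) :
    ∃ δ > 0, Metric.ball xs δ ⊆ trappingSet P mP w xs ρ := by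
  have hwρ : 0 < w ρ := by
    have := hw.strictMonoOn (mem_Ici.2 le_rfl) (mem_Ici.2 hρ.le) hρ
    rwa [hw.map_zero] at this
  have h1 : ∀ᶠ y in 𝓝 xs, P y < mP + w ρ :=
    hP.eventually_lt continuousAt_const (by linarith)
  obtain ⟨δ, hδ, hsub⟩ := Metric.mem_nhds_iff.1
    (Filter.inter_mem h1 (Metric.closedBall_mem_nhds xs hρ))
  refine ⟨δ, hδ, fun y hy => ⟨(hsub hy).2, ?_⟩⟩
  have : P y < mP + w ρ := (hsub hy).1
  linarith

/-- The trapping sets are invariant under the sampled dynamics. -/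
theorem HasPeriodDescent.mem_trappingSet (h : HasPeriodDescent f S₁ S₂ κ P γ ε xs R c)
    (hγ : 0 < γ) (hε : 0 < ε) (hw : IsClassK w) (hRD : Metric.closedBall xs (2 * R) ⊆ D)
    (hlow : ∀ x ∈ D, w ‖x - xs‖ ≤ P x - mP) {ρ : ℝ} (hρ : 0 ≤ ρ) (hρR : ρ ≤ R) {s : ℝ}
    {x : ℝ → State n} (hxs : x s ∈ trappingSet P mP w xs ρ)
    (hx : IsPeriodSolution f S₁ S₂ κ ε (coeff f S₁ S₂ P γ (x s)) s x) :
    x (s + ε) ∈ trappingSet P mP w xs ρ := by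
  have hsR : x s ∈ Metric.closedBall xs R := Metric.closedBall_subset_closedBall hρR hxs.1
  have hd := h.descent s x hsR hx
  have h0 : 0 ≤ γ / 2 * ε * ‖gradient P (x s)‖ ^ 2 := by positivity
  have h2 := hxs.2
  have hle : P (x (s + ε)) - mP ≤ w ρ := by linarith
  refine ⟨?_, hle⟩
  have hmem := hRD (h.mem s x hsR hx (s + ε) ⟨by linarith, le_rfl⟩)
  rw [mem_closedBall_iff_norm]
  -- Confinement alone gives only the ball of radius 2R, which lies in `D`. There w‖x - x*‖ ≤ P -
  -- m_P ≤ w(ρ), and strict monotonicity brings the radius back to ρ.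
  exact (hw.strictMonoOn.le_iff_le (mem_Ici.2 (norm_nonneg _)) (mem_Ici.2 hρ)).1
    ((hlow _ hmem).trans hle)

theorem IsClosedLoopSolution.sample_mem_trappingSet
    (h : HasPeriodDescent f S₁ S₂ κ P γ ε xs R c)
    (hγ : 0 < γ) (hε : 0 < ε) (hw : IsClassK w) (hRD : Metric.closedBall xs (2 * R) ⊆ D)
    (hlow : ∀ x ∈ D, w ‖x - xs‖ ≤ P x - mP) {ρ : ℝ} (hρ : 0 ≤ ρ) (hρR : ρ ≤ R) {t₀ : ℝ}
    {x₀ : State n} {x : ℝ → State n} (hx : IsClosedLoopSolution D f S₁ S₂ κ P γ ε t₀ x₀ x)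
    (hx₀ : x₀ ∈ trappingSet P mP w xs ρ) (j : ℕ) :
    x (t₀ + ε * j) ∈ trappingSet P mP w xs ρ := by
  induction j with
  | zero => simpa [hx.init] using hx₀
  | succ j ih =>
    have := h.mem_trappingSet hγ hε hw hRD hlow hρ hρR ih (hx.isPeriodSolution hε j)
    convert this using 2
    push_cast
    ring

theorem mem_Ico_floor (hε : 0 < ε) {t₀ t : ℝ} (ht : t₀ ≤ t) :
    t ∈ Ico (t₀ + ε * ⌊(t - t₀) / ε⌋₊) (t₀ + ε * ⌊(t - t₀) / ε⌋₊ + ε) := by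
  have h1 := Nat.floor_le (div_nonneg (sub_nonneg.2 ht) hε.le)
  have h2 := Nat.lt_floor_add_one ((t - t₀) / ε)
  rw [le_div_iff₀ hε] at h1
  rw [div_lt_iff₀ hε] at h2
  constructor <;> linarith

theorem floor_eq_of_mem_Ico (hε : 0 < ε) {t₀ t : ℝ} {j : ℕ}
    (ht : t ∈ Ico (t₀ + ε * j) (t₀ + ε * j + ε)) : ⌊(t - t₀) / ε⌋₊ = j := by
  have h0 : 0 ≤ ε * j := by positivity
  rw [Nat.floor_eq_iff (div_nonneg (by linarith [ht.1]) hε.le), le_div_iff₀ hε, div_lt_iff₀ hε]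
  constructor <;> linarith [ht.1, ht.2]

theorem IsClosedLoopSolution.norm_sub_sample_le
    (h : HasPeriodDescent f S₁ S₂ κ P γ ε xs R c) (hε : 0 < ε) {t₀ : ℝ} {x₀ : State n}
    {x : ℝ → State n} (hx : IsClosedLoopSolution D f S₁ S₂ κ P γ ε t₀ x₀ x)
    (hR : ∀ j : ℕ, x (t₀ + ε * j) ∈ Metric.closedBall xs R) {t : ℝ} (ht : t₀ ≤ t) :
    ‖x t - xs‖ ≤ ‖x (t₀ + ε * ⌊(t - t₀) / ε⌋₊) - xs‖ +
      c * √‖gradient P (x (t₀ + ε * ⌊(t - t₀) / ε⌋₊))‖ := by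
  have := h.norm_sub_le _ x (hR _) (hx.isPeriodSolution hε ⌊(t - t₀) / ε⌋₊) t
    (Ico_subset_Icc_self (mem_Ico_floor hε ht))
  have h3 := norm_sub_le_norm_sub_add_norm_sub (x t) (x (t₀ + ε * ⌊(t - t₀) / ε⌋₊)) xs
  linarith

/-- The bound of `norm_sub_sample_le` is a continuous function of the last sample vanishing at `xs`,
so confining the samples to a small trapping set controls all intermediate times. -/
theorem IsClosedLoopSolution.stable (hcont : ContinuousAt (gradient P) xs)
    (hgrad : gradient P xs = 0)
    (h : HasPeriodDescent f S₁ S₂ κ P γ ε xs R c) (hR : 0 < R)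
    (hγ : 0 < γ) (hε : 0 < ε) (hw : IsClassK w) (hRD : Metric.closedBall xs (2 * R) ⊆ D)
    (hlow : ∀ x ∈ D, w ‖x - xs‖ ≤ P x - mP) (hP : ContinuousAt P xs) (hPxs : P xs = mP)
    {η : ℝ} (hη : 0 < η) :
    ∃ δ > 0, ∀ t₀ : ℝ, ∀ x₀ : State n, ‖x₀ - xs‖ < δ → ∀ x,
      IsClosedLoopSolution D f S₁ S₂ κ P γ ε t₀ x₀ x → ∀ t, t₀ ≤ t → ‖x t - xs‖ < η := by
  have h1 : Filter.Tendsto (fun y => ‖y - xs‖ + c * √‖gradient P y‖) (𝓝 xs) (𝓝 0) := by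
    have h2 : ContinuousAt (fun y => ‖y - xs‖ + c * √‖gradient P y‖) xs := by fun_prop
    simpa [ContinuousAt, hgrad] using h2
  obtain ⟨ρ', hρ', hsub⟩ := Metric.nhds_basis_closedBall.mem_iff.1 (h1.eventually_lt_const hη)
  have hρ : 0 < min ρ' R := by positivity
  obtain ⟨δ, hδ, hball⟩ := exists_ball_subset_trappingSet hw hP hPxs hρ
  refine ⟨δ, hδ, fun t₀ x₀ hx₀ x hx t ht => ?_⟩
  have hmem := fun j => hx.sample_mem_trappingSet h hγ hε hw hRD hlow hρ.le (min_le_right _ _)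
    (hball (mem_ball_iff_norm.2 hx₀)) j
  refine (hx.norm_sub_sample_le h hε (fun j => Metric.closedBall_subset_closedBall
    (min_le_right _ _) (hmem j).1) ht).trans_lt ?_
  exact hsub (Metric.closedBall_subset_closedBall (min_le_left _ _) (hmem _).1)

theorem IsClosedLoopSolution.tendsto
    (hcont : ∀ y ∈ Metric.closedBall xs R, ContinuousAt (gradient P) y)
    (hgrad : ∀ y ∈ Metric.closedBall xs R, gradient P y = 0 ↔ y = xs)
    (h : HasPeriodDescent f S₁ S₂ κ P γ ε xs R c) (hR : 0 < R)
    (hγ : 0 < γ) (hε : 0 < ε) (hw : IsClassK w) (hRD : Metric.closedBall xs (2 * R) ⊆ D)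
    (hlow : ∀ x ∈ D, w ‖x - xs‖ ≤ P x - mP) {t₀ : ℝ} {x₀ : State n} {x : ℝ → State n}
    (hx : IsClosedLoopSolution D f S₁ S₂ κ P γ ε t₀ x₀ x)
    (hx₀ : x₀ ∈ trappingSet P mP w xs R) :
    Filter.Tendsto x Filter.atTop (𝓝 xs) := by
  set y : ℕ → State n := fun j => x (t₀ + ε * j) with hy
  have hmem : ∀ j, y j ∈ Metric.closedBall xs R := fun j =>
    (hx.sample_mem_trappingSet h hγ hε hw hRD hlow hR.le le_rfl hx₀ j).1
  have hsub : Metric.closedBall xs R ⊆ D :=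
    (Metric.closedBall_subset_closedBall (by linarith)).trans hRD
  have hlow' : ∀ j, mP ≤ P (y j) := by
    intro j
    have h1 := hlow _ (hsub (hmem j))
    have h2 := hw.strictMonoOn.monotoneOn (mem_Ici.2 le_rfl) (mem_Ici.2 (norm_nonneg (y j - xs)))
      (norm_nonneg _)
    rw [hw.map_zero] at h2
    linarith
  have hdesc : ∀ j, γ / 2 * ε * ‖gradient P (y j)‖ ^ 2 ≤ P (y j) - P (y (j + 1)) := by
    intro j
    have h1 := h.descent _ x (hmem j) (hx.isPeriodSolution hε j)
    have h2 : y (j + 1) = x (t₀ + ε * j + ε) := by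
      simp only [hy]
      congr 1
      push_cast
      ring
    rw [h2]
    linarith
  -- The decreases telescope, and P is bounded below by `mP` along the samples.
  have hsum : Summable fun j => γ / 2 * ε * ‖gradient P (y j)‖ ^ 2 := by
    refine summable_of_sum_range_le (c := P (y 0) - mP) (fun j => by positivity) fun N => ?_
    refine (Finset.sum_le_sum fun j _ => hdesc j).trans ?_
    rw [Finset.sum_range_sub' (fun j => P (y j))]
    linarith [hlow' N]
  have hg0 : Filter.Tendsto (fun j => ‖gradient P (y j)‖) Filter.atTop (𝓝 0) := by
    have h1 := hsum.tendsto_atTop_zero.const_mul (γ / 2 * ε)⁻¹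
    have h2 : Filter.Tendsto (fun j => ‖gradient P (y j)‖ ^ 2) Filter.atTop (𝓝 0) := by
      have hne : γ / 2 * ε ≠ 0 := by positivity
      rw [mul_zero] at h1
      exact h1.congr fun j => inv_mul_cancel_left₀ hne _
    simpa using h2.sqrt
  have hy0 : Filter.Tendsto y Filter.atTop (𝓝 xs) := by
    -- By continuity of ∇P every cluster point of the samples is critical, hence equal to `xs`;
    -- compactness turns this into convergence.
    refine (isCompact_closedBall xs R).tendsto_nhds_of_unique_mapClusterPt
      (Filter.Eventually.of_forall hmem) fun z hz hcl => ?_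
    rw [← hgrad z hz, ← norm_eq_zero]
    have h1 : MapClusterPt ‖gradient P z‖ Filter.atTop (fun j => ‖gradient P (y j)‖) :=
      hcl.continuousAt_comp (f := fun y => ‖gradient P y‖) (hcont z hz).norm
    exact eq_of_nhds_neBot (h1.neBot.mono (inf_le_inf_left _ hg0))
  have hfloor : Filter.Tendsto (fun t : ℝ => ⌊(t - t₀) / ε⌋₊) Filter.atTop Filter.atTop :=
    tendsto_nat_floor_atTop.comp
      ((Filter.tendsto_atTop_add_const_right _ (-t₀) Filter.tendsto_id).atTop_div_const hε)
  have hlim : Filter.Tendsto (fun j => ‖y j - xs‖ + c * √‖gradient P (y j)‖) Filter.atTop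
      (𝓝 0) := by
    simpa using (tendsto_iff_norm_sub_tendsto_zero.1 hy0).add (hg0.sqrt.const_mul c)
  rw [tendsto_iff_norm_sub_tendsto_zero]
  refine squeeze_zero' (Filter.Eventually.of_forall fun _ => norm_nonneg _) ?_
    (hlim.comp hfloor)
  filter_upwards [Filter.eventually_ge_atTop t₀] with t ht
  exact hx.norm_sub_sample_le h hε hmem ht

end Iteration

/-! ### Gluing period solutions into a global one -/

section Existence

/-- Curves `φ j`, each continuous on the `j`-th period, glue to a continuous curve. -/
theorem continuousOn_Icc_of_periods {X : Type*} [TopologicalSpace X] {x : ℝ → X} {ε t₀ : ℝ}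
    (hε : 0 < ε)
    (h : ∀ j : ℕ, ContinuousOn x (Icc (t₀ + ε * j) (t₀ + ε * j + ε))) (T : ℝ) :
    ContinuousOn x (Icc t₀ T) := by
  have key : ∀ N : ℕ, ContinuousOn x (Icc t₀ (t₀ + ε * N)) := by
    intro N
    induction N with
    | zero =>
      refine (h 0).mono (Icc_subset_Icc ?_ ?_) <;> simp [hε.le]
    | succ N ih =>
      have := ih.union_of_isClosed (h N) isClosed_Icc isClosed_Icc
      have h0 : 0 ≤ ε * N := by positivity
      rw [Icc_union_Icc_eq_Icc (by linarith) (by linarith)] at this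
      rwa [Nat.cast_succ, mul_add_one, ← add_assoc]
  obtain ⟨N, hN⟩ := exists_nat_ge ((T - t₀) / ε)
  refine (key N).mono (Icc_subset_Icc_right ?_)
  rw [div_le_iff₀ hε] at hN
  linarith

variable {n m : ℕ} {D : Set (State n)} {f : Fin m → State n → State n} {S₁ : Finset (Fin m)}
  {S₂ : Finset (Fin m × Fin m)} {κ : Fin m × Fin m → ℕ} {P : State n → ℝ} {γ ε : ℝ}
  {xs : State n} {mP : ℝ} {w : ℝ → ℝ} {R c K : ℝ}

theorem isPeriodSolution_of_hasDerivWithinAt {a : Label S₁ S₂ → ℝ} {s : ℝ} {x : ℝ → State n}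
    (hx : ∀ t ∈ Icc s (s + ε),
      HasDerivWithinAt x (driftless f (x t) (oscControl S₁ S₂ κ ε a t) t) (Icc s (s + ε)) t) :
    IsPeriodSolution f S₁ S₂ κ ε a s x where
  continuousOn := HasDerivWithinAt.continuousOn hx
  hasDerivWithinAt t ht := (hx t (Ico_subset_Icc_self ht)).mono_of_mem_nhdsWithin
    (Icc_mem_nhdsGE_of_mem ht)

theorem HasPeriodDescent.exists_closedLoopSolution
    (h : HasPeriodDescent f S₁ S₂ κ P γ ε xs R c) (hR : 0 < R)
    (hγ : 0 < γ) (hε : 0 < ε) (hw : IsClassK w) (hRD : Metric.closedBall xs (2 * R) ⊆ D)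
    (hlow : ∀ x ∈ D, w ‖x - xs‖ ≤ P x - mP) (hK : 0 ≤ K)
    (hfb : FieldBounds f (Metric.closedBall xs (2 * R)) K) (t₀ : ℝ) {x₀ : State n}
    (hx₀ : x₀ ∈ trappingSet P mP w xs R) :
    ∃ x, IsClosedLoopSolution D f S₁ S₂ κ P γ ε t₀ x₀ x := by
  choose! φ hφs hφ using h.exists_solution
  -- The samples are defined by recursion on the end points of period solutions. `φ` is meaningful
  -- only for starting points in the ball of radius R, where the trapping set keeps every sample.
  let y : ℕ → State n := fun j =>
    Nat.rec x₀ (fun j z => φ z (t₀ + ε * j) (t₀ + ε * j + ε)) j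
  have hy0 : y 0 = x₀ := rfl
  have hysucc : ∀ j : ℕ, y (j + 1) = φ (y j) (t₀ + ε * j) (t₀ + ε * j + ε) := fun j => rfl
  clear_value y
  have hφp : ∀ z ∈ Metric.closedBall xs R, ∀ s,
      IsPeriodSolution f S₁ S₂ κ ε (coeff f S₁ S₂ P γ z) s (φ z s) := fun z hz s =>
    isPeriodSolution_of_hasDerivWithinAt (hφ z hz s)
  have hmem : ∀ j, y j ∈ trappingSet P mP w xs R := by
    intro j
    induction j with
    | zero => rwa [hy0]
    | succ j ih =>
      rw [hysucc]
      refine h.mem_trappingSet hγ hε hw hRD hlow hR.le le_rfl ?_ ?_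
      · rwa [hφs _ ih.1]
      · rw [hφs _ ih.1]
        exact hφp _ ih.1 _
  let x : ℝ → State n := fun t => φ (y ⌊(t - t₀) / ε⌋₊) (t₀ + ε * ⌊(t - t₀) / ε⌋₊) t
  have hxIco : ∀ j : ℕ, ∀ t ∈ Ico (t₀ + ε * j) (t₀ + ε * j + ε),
      x t = φ (y j) (t₀ + ε * j) t := by
    intro j t ht
    simp only [x]
    rw [floor_eq_of_mem_Ico hε ht]
  have hxs : ∀ j : ℕ, x (t₀ + ε * j) = y j := by
    intro j
    rw [hxIco j _ ⟨le_rfl, by linarith⟩, hφs _ (hmem j).1]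
  -- At the right endpoint the floor already selects the next piece, which starts where this one
  -- ends.
  have hxIcc : ∀ j : ℕ, EqOn x (φ (y j) (t₀ + ε * j)) (Icc (t₀ + ε * j) (t₀ + ε * j + ε)) := by
    intro j t ht
    rcases ht.2.lt_or_eq with h1 | h1
    · exact hxIco j t ⟨ht.1, h1⟩
    · have h2 := hxs (j + 1)
      rw [hysucc] at h2
      rw [h1, ← h2]
      congr 1
      push_cast
      ring
  have hτ : ∀ j : ℕ, t₀ + ε * ((j : ℝ) + 1) = t₀ + ε * j + ε := fun j => by ring
  have hxball : ∀ t, t₀ ≤ t → x t ∈ Metric.closedBall xs (2 * R) := by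
    intro t ht
    have hz := (hmem ⌊(t - t₀) / ε⌋₊).1
    exact h.mem _ (φ _ _) (by rwa [hφs _ hz]) (by rw [hφs _ hz]; exact hφp _ hz _) t
      (Ico_subset_Icc_self (mem_Ico_floor hε ht))
  have hode : ∀ j : ℕ, ∀ t ∈ Ico (t₀ + ε * j) (t₀ + ε * j + ε), HasDerivWithinAt x
      (driftless f (x t) (oscControl S₁ S₂ κ ε (coeff f S₁ S₂ P γ (y j)) t) t)
      (Ico (t₀ + ε * j) (t₀ + ε * j + ε)) t := by
    intro j t ht
    have h1 := (hφ _ (hmem j).1 (t₀ + ε * j) t (Ico_subset_Icc_self ht)).mono Ico_subset_Icc_self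
    rw [← hxIco j t ht] at h1
    exact h1.congr (hxIco j) (hxIco j t ht)
  have hcont : ∀ T, ContinuousOn x (Icc t₀ T) := continuousOn_Icc_of_periods hε fun j =>
    (HasDerivWithinAt.continuousOn (hφ _ (hmem j).1 (t₀ + ε * j))).congr (hxIcc j)
  have hb0 := controlBound_nonneg S₁ S₂ κ
  -- Since q ≤ 1 at every sample, one speed bound serves all periods; the resulting Lipschitz
  -- estimate yields absolute continuity.
  have hlip : ∀ a b, t₀ ≤ a → a ≤ b →
      ‖x b - x a‖ ≤ 2 * m * K * controlBound S₁ S₂ κ / ε * (b - a) := by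
    intro a b ha hab
    refine norm_image_sub_le_of_norm_deriv_right_le_segment
      (f' := fun t => driftless f (x t)
        (oscControl S₁ S₂ κ ε (coeff f S₁ S₂ P γ (y ⌊(t - t₀) / ε⌋₊)) t) t)
      ((hcont b).mono (Icc_subset_Icc_left ha)) (fun t ht => ?_) (fun t ht => ?_) b ⟨hab, le_rfl⟩
    · have ht' := mem_Ico_floor hε (ha.trans ht.1)
      exact (hode _ t ht').mono_of_mem_nhdsWithin (Ico_mem_nhdsGE_of_mem ht')
    · have h1 := h.sqrt_le_one _ (hmem ⌊(t - t₀) / ε⌋₊).1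
      refine (norm_driftless_le hfb hε _ h1 t (hxball t (ha.trans ht.1))).trans ?_
      refine div_le_div_of_nonneg_right ?_ hε.le
      exact mul_le_of_le_one_right (mul_nonneg (by positivity) hb0) h1
  refine ⟨x, ?_, fun t ht => hRD (hxball t ht), ?_, ?_⟩
  · intro T hT
    refine LipschitzOnWith.absolutelyContinuousOnInterval
      (K := .mk (2 * m * K * controlBound S₁ S₂ κ / ε) (by positivity)) ?_
    refine LipschitzOnWith.of_dist_le_mul fun a ha b hb => ?_
    rw [uIcc_of_le hT] at ha hb
    rw [dist_eq_norm, Real.dist_eq, NNReal.coe_mk]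
    rcases le_total a b with hab | hab
    · rw [norm_sub_rev, abs_sub_comm, abs_of_nonneg (sub_nonneg.2 hab)]
      exact hlip a b ha.1 hab
    · rw [abs_of_nonneg (sub_nonneg.2 hab)]
      exact hlip b a hb.1 hab
  · have := hxs 0
    rwa [hy0, Nat.cast_zero, mul_zero, add_zero] at this
  · intro j t ht
    rw [hτ] at ht ⊢
    rw [hxs]
    exact hode j t ht

end Existence

end NonholonomicStab

/-! ### Assembly of the main theorem -/

open NonholonomicStab in
theorem mainTheorem1 {n m : ℕ}
    (D : Set (NonholonomicStab.State n)) (hD_open : IsOpen D) (hD_conn : IsConnected D)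
    (f : Fin m → NonholonomicStab.State n → NonholonomicStab.State n)
    (hf : ∀ k, ContDiffOn ℝ 2 (f k) D)
    (S₁ : Finset (Fin m)) (S₂ : Finset (Fin m × Fin m))
    (hS : NonholonomicStab.IsBracketGenerating f D S₁ S₂)
    (κ : Fin m × Fin m → ℕ) (hκ_pos : ∀ j ∈ S₂, 0 < κ j)
    (hκ_inj : Set.InjOn κ (S₂ : Set (Fin m × Fin m)))
    (xs : NonholonomicStab.State n) (hxs : xs ∈ D)
    (P : NonholonomicStab.State n → ℝ) (hP : ContDiffOn ℝ 2 P D) (mP : ℝ)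
    (w₁₁ w₁₂ w₂ : ℝ → ℝ)
    (hw₁₁ : NonholonomicStab.IsClassK w₁₁) (hw₁₂ : NonholonomicStab.IsClassK w₁₂)
    (hw₂ : NonholonomicStab.IsClassK w₂)
    (hball : ∀ x₀ ∈ D, ∀ r : ℝ, 0 ≤ r → w₁₁ r = P x₀ - mP → Metric.closedBall xs r ⊆ D)
    (hP_lower : ∀ x ∈ D, w₁₁ ‖x - xs‖ ≤ P x - mP)
    (hP_upper : ∀ x ∈ D, P x - mP ≤ w₁₂ ‖x - xs‖)
    (hgrad_zero : ∀ x ∈ D, ‖gradient P x‖ = 0 ↔ x = xs)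
    (hgrad_upper : ∀ x ∈ D, ‖gradient P x‖ ≤ w₂ ‖x - xs‖) :
    ∀ γ : ℝ, 0 < γ → ∃ εbar : ℝ, 0 < εbar ∧ ∀ ε : ℝ, 0 < ε → ε < εbar →
      NonholonomicStab.IsAsymptoticallyStable
        (NonholonomicStab.IsClosedLoopSolution D f S₁ S₂ κ P γ ε) xs := by
  intro γ hγ
  obtain ⟨R, hR, hRD, K, hK, hfb, c, -, εbar, hεbar, H⟩ :=
    exists_period_descent hD_open hf hS hκ_pos hκ_inj hxs hP hγ
  refine ⟨εbar, hεbar, fun ε hε hεlt => ?_⟩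
  have h := H ε hε hεlt
  have hRD' : Metric.closedBall xs R ⊆ D :=
    (Metric.closedBall_subset_closedBall (by linarith)).trans hRD
  have hPd : ∀ y ∈ D, ContDiffAt ℝ 2 P y := fun y hy => hP.contDiffAt (hD_open.mem_nhds hy)
  have hgc : ∀ y ∈ D, ContinuousAt (gradient P) y := fun y hy =>
    (contDiffAt_gradient (hPd y hy)).continuousAt
  -- Both class 𝒦 bounds vanish at distance 0 and squeeze P - m_P there.
  have hPxs : P xs = mP := by
    have h1 := hP_lower xs hxs
    have h2 := hP_upper xs hxs
    rw [sub_self, norm_zero, hw₁₁.map_zero] at h1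
    rw [sub_self, norm_zero, hw₁₂.map_zero] at h2
    linarith
  have hgrad : ∀ y ∈ D, gradient P y = 0 ↔ y = xs := fun y hy => by
    rw [← norm_eq_zero, hgrad_zero y hy]
  obtain ⟨δ, hδ, hsub⟩ :=
    exists_ball_subset_trappingSet hw₁₁ (hPd xs hxs).continuousAt hPxs hR
  refine ⟨⟨δ, hδ, fun t₀ x₀ hx₀ => ?_⟩, fun η hη => ?_, ⟨δ, hδ, fun t₀ x₀ hx₀ x hx => ?_⟩⟩
  · exact h.exists_closedLoopSolution hR hγ hε hw₁₁ hRD hP_lower hK hfb t₀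
      (hsub (mem_ball_iff_norm.2 hx₀))
  · exact IsClosedLoopSolution.stable (hgc xs hxs) ((hgrad xs hxs).2 rfl) h hR hγ hε hw₁₁ hRD
      hP_lower (hPd xs hxs).continuousAt hPxs hη
  · exact hx.tendsto (fun y hy => hgc y (hRD' hy)) (fun y hy => hgrad y (hRD' hy)) h hR hγ hε hw₁₁
      hRD hP_lower (hsub (mem_ball_iff_norm.2 hx₀))
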